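/- All graphs are finite, undirected and simple. For $k\ge 0$ let $\mathcal{D}_k$ be the class of graphs $G$ such that every minor of $G$ has minimum degree at most $k$, and let $\widehat{\mathcal{D}}_k$ be the set of its minimal forbidden minors, that is, the graphs $G\notin\mathcal{D}_k$ such that every proper minor of $G$ is in $\mathcal{D}_k$. The block decomposition tree of a connected graph $G$ has as its vertices the blocks of $G$ (cut-edges and maximal $2$-connected subgraphs) and the cut-vertices of $G$, a block $b$ being adjacent to a cut-vertex $c$ whenever $b$ contains $c$. A low-high tree is a tree $T$ that admits a bipartition $V(T)=V_\ell\cup V_h$ (every edge having one end in $V_\ell$ and the other in $V_h$) such that every vertex in $V_\ell$ has degree at most $2$ and every vertex in $V_h$ has degree at least $2$. Theorem. For every low-high tree $T$ with at least one edge there are an integer $d$ and a connected graph $G$ such that (G1) $G$ is $d$-regular; (G2) $T$ is (isomorphic to) the block decomposition tree of $G$; (G3) $8\le d\le 4|E(T)|$; and (G4) $G\in\widehat{\mathcal{D}}_{d-1}$. -/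

import Mathlib

namespace SimpleGraph

/-! ### Minors and minimal forbidden minors -/

/-- `H` is a minor of `G`: there are pairwise disjoint branch sets, each non-empty and inducing a
connected subgraph of `G`, indexed by the vertices of `H`, such that adjacent vertices of `H` have
branch sets joined by an edge of `G`. Equivalently, a graph isomorphic to `H` is obtained from a
subgraph of `G` by contracting edges. -/
def IsMinor {W V : Type*} (H : SimpleGraph W) (G : SimpleGraph V) : Prop :=
  ∃ B : W → Set V,
    (∀ w, (G.induce (B w)).Connected) ∧
    (∀ a b, a ≠ b → Disjoint (B a) (B b)) ∧
    (∀ a b, H.Adj a b → ∃ x ∈ B a, ∃ y ∈ B b, G.Adj x y)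

/-- A minor of `G` that is not isomorphic to `G` (for finite graphs: a minor other than `G`
itself). -/
def IsProperMinor {W V : Type*} (H : SimpleGraph W) (G : SimpleGraph V) : Prop :=
  H.IsMinor G ∧ ¬ Nonempty (H ≃g G)

/-- `G` is a minimal forbidden minor of the class `X`: `G` is not in `X`, but every proper minor
of `G` is in `X`. -/
def IsMinimalForbiddenMinor (X : ∀ V : Type, SimpleGraph V → Prop)
    {V : Type} (G : SimpleGraph V) : Prop :=
  ¬ X V G ∧ ∀ (W : Type) [Finite W] (H : SimpleGraph W), H.IsProperMinor G → X W H

/-- The class `𝒟_k` of graphs for which every minor has minimum degree at most `k`. -/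
def MinorMinDegreeLE (k : ℕ) (V : Type) (G : SimpleGraph V) : Prop :=
  ∀ (W : Type) [Fintype W] (H : SimpleGraph W) [DecidableRel H.Adj],
    H.IsMinor G → H.minDegree ≤ k

/-! ### Blocks, cut-vertices and the block decomposition tree -/

/-- The vertex set `S` has at least three elements, and the subgraph induced by `S` is connected
and remains connected when any one vertex is deleted. -/
def IsTwoConnectedOn {V : Type*} (G : SimpleGraph V) (S : Set V) : Prop :=
  3 ≤ S.encard ∧ (G.induce S).Connected ∧ ∀ v ∈ S, (G.induce (S \ {v})).Connected

/-- `S` is the vertex set of a block of `G`, that is, of a cut-edge or of a maximal 2-connected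
subgraph. Blocks are induced subgraphs, so a block is identified with its vertex set. -/
def IsBlock {V : Type*} (G : SimpleGraph V) (S : Set V) : Prop :=
  (∃ u v, G.Adj u v ∧ G.IsBridge s(u, v) ∧ S = {u, v}) ∨ Maximal G.IsTwoConnectedOn S

/-- Deleting `c` disconnects two vertices, other than `c`, that are connected in `G`. -/
def IsCutVertex {V : Type*} (G : SimpleGraph V) (c : V) : Prop :=
  ∃ (u w : V) (hu : u ∈ ({c}ᶜ : Set V)) (hw : w ∈ ({c}ᶜ : Set V)),
    G.Reachable u w ∧ ¬ (G.induce {c}ᶜ).Reachable ⟨u, hu⟩ ⟨w, hw⟩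

/-- The graph whose vertices are the blocks and the cut-vertices of `G`, where a block `b` and a
cut-vertex `c` are adjacent whenever `b` contains `c`. -/
def blockGraph {V : Type*} (G : SimpleGraph V) :
    SimpleGraph ({S : Set V // G.IsBlock S} ⊕ {c : V // G.IsCutVertex c}) :=
  SimpleGraph.fromRel fun x y =>
    ∃ (b : {S : Set V // G.IsBlock S}) (c : {c : V // G.IsCutVertex c}),
      x = Sum.inl b ∧ y = Sum.inr c ∧ c.1 ∈ b.1

/-- `T` is (isomorphic to) the block decomposition tree of the connected graph `G`. -/
def IsBlockDecompositionTreeOf {U V : Type*} (T : SimpleGraph U) (G : SimpleGraph V) : Prop :=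
  G.Connected ∧ Nonempty (T ≃g G.blockGraph)

/-! ### Low-high trees -/

/-- A tree with a bipartition into a set `Vl` of low vertices, all of degree at most `2`, and a set
`Vh` of high vertices, all of degree at least `2`. -/
def IsLowHighTree {U : Type*} [Fintype U] (T : SimpleGraph U) [DecidableRel T.Adj] : Prop :=
  T.IsTree ∧ ∃ Vl Vh : Set U,
    Vl ∪ Vh = Set.univ ∧ T.IsBipartiteWith Vl Vh ∧
    (∀ v ∈ Vl, T.degree v ≤ 2) ∧ (∀ v ∈ Vh, 2 ≤ T.degree v)

end SimpleGraph

/-! Read the low vertices of `T` as the edges of a tree on the high vertices, a low leaf receiving a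
dummy second end. Let `m` be their number and `d = 4m`. Each edge becomes a block on `d + 2`
vertices: its two ends and `d` interior vertices, each missing exactly one other vertex of the
block. Inside the block of `b`, an end `c` sees four interior vertices for `b` and four for each
edge beyond `b` as seen from `c`. Every edge equals or lies beyond exactly one edge at `c`, so `c`
has degree `d` (`sum_weight`), whereas the two ends of one block have degrees in it that add up to
`d + 4` (`weight_add`).

Minimality follows from rigidity: a nonempty minor of minimum degree at least `d` has every single
vertex as a branch set. If a branch set lies in the interior of a block, its neighbours all meet
that block, so at least `d + 1` branch sets share `d + 2` vertices; three disjoint non-adjacent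
pairs then rule out any loss (`discrete_of_subset_interior`). If a branch set contains `k` ends,
their total degree is `kd`, but connectivity forces at least `k - 1` blocks with both ends in the
set. Each of them wastes `d + 4`, which leaves fewer than `d` neighbours unless `k = 1` and the
blocks at that end are intact (`discrete_of_end_mem`). Intactness then spreads along the tree
(`exists_branch_eq_singleton`). -/

/-- A tree with edge set `L` and vertex set `C`: every edge `b` has the two ends `e b true` and
`e b false`, and deleting it splits the vertices into two sides, recorded by `side b`. -/
structure EdgeTree (L C : Type*) where
  e : L → Bool → C
  side : L → C → Bool
  side_e : ∀ b s, side b (e b s) = s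
  side_eq : ∀ b b₁, b₁ ≠ b → ∀ s t, side b (e b₁ s) = side b (e b₁ t)
  conn : ∀ P : C → Prop, (∀ b s t, P (e b s) → P (e b t)) → ∀ c c', P c → P c'

/-! ### Sides of the edges of a tree -/

namespace EdgeTree

variable {L C : Type*} (A : EdgeTree L C)

/-- The vertex `c` is an end of the edge `b`. -/
def Inc (b : L) (c : C) : Prop := A.e b (A.side b c) = c

/-- The side of `b` on which the edge `b₁` lies. -/
def toward (b b₁ : L) : Bool := A.side b (A.e b₁ true)

lemma inc_e (b : L) (s : Bool) : A.Inc b (A.e b s) := by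
  unfold Inc; rw [A.side_e]

lemma side_of_inc {b b₁ : L} {c : C} (h : A.Inc b₁ c) (hb : b₁ ≠ b) :
    A.side b c = A.toward b b₁ := by
  rw [← h]; exact A.side_eq b b₁ hb _ _

lemma e_injective (b : L) : Function.Injective (A.e b) := fun s t h => by
  rw [← A.side_e b s, ← A.side_e b t, h]

/-- Every vertex other than `c` is separated from `c` by an edge at `c`. -/
lemma exists_inc_side_ne {c t : C} (h : t ≠ c) : ∃ b, A.Inc b c ∧ A.side b t ≠ A.side b c := by
  have := A.conn (fun x => x = c ∨ ∃ b, A.Inc b c ∧ A.side b x ≠ A.side b c) ?_ c t (Or.inl rfl)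
  · exact this.resolve_left h
  · intro b s t hs
    by_cases hc : A.e b t = c
    · exact Or.inl hc
    right
    by_cases hb : A.Inc b c
    · refine ⟨b, hb, fun h' => hc ?_⟩
      rw [A.side_e] at h'
      rw [h']; exact hb
    · rcases hs with hs | ⟨b', hb', hs⟩
      · exact absurd (hs ▸ A.inc_e b s) hb
      · refine ⟨b', hb', ?_⟩
        have hne : b ≠ b' := fun h' => hb (h' ▸ hb')
        rwa [A.side_eq b' b hne t s]

/-- Among the edges at `c` exactly one is equal to `b₁` or leads from `c` to `b₁`. -/
lemma existsUnique_toward (c : C) (b₁ : L) :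
    ∃! b, A.Inc b c ∧ (b₁ = b ∨ A.toward b b₁ ≠ A.side b c) := by
  -- The parts beyond two different edges at `c` are disjoint: the set of vertices beyond both is
  -- closed under adjacency, so if nonempty it would contain `c`.
  have key : ∀ b b', A.Inc b c → A.Inc b' c → b ≠ b' → ∀ x,
      A.side b x ≠ A.side b c → A.side b' x = A.side b' c := by
    intro b b' hb hb' hne x hx
    by_contra hx'
    have := A.conn (fun x => A.side b x ≠ A.side b c ∧ A.side b' x ≠ A.side b' c) ?_ x c ⟨hx, hx'⟩
    · exact this.1 rfl
    · rintro f s t ⟨h1, h2⟩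
      have hf : f ≠ b := by
        rintro rfl
        apply h2
        rw [A.side_of_inc (A.inc_e f s) hne, A.side_of_inc hb hne]
      have hf' : f ≠ b' := by
        rintro rfl
        apply h1
        rw [A.side_of_inc (A.inc_e f s) hne.symm, A.side_of_inc hb' hne.symm]
      rw [A.side_eq b f hf t s, A.side_eq b' f hf' t s]
      exact ⟨h1, h2⟩
  have hex : ∃ b, A.Inc b c ∧ (b₁ = b ∨ A.toward b b₁ ≠ A.side b c) := by
    by_cases h : A.e b₁ true = c
    · exact ⟨b₁, h ▸ A.inc_e b₁ true, Or.inl rfl⟩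
    · obtain ⟨b, hb, hs⟩ := A.exists_inc_side_ne h
      exact ⟨b, hb, Or.inr hs⟩
  obtain ⟨b, hb, h⟩ := hex
  refine ⟨b, ⟨hb, h⟩, ?_⟩
  rintro b' ⟨hb', h'⟩
  by_contra hne
  rcases h with rfl | h
  · rcases h' with rfl | h'
    · exact hne rfl
    · exact h' (A.side_of_inc hb (Ne.symm hne)).symm
  · rcases h' with rfl | h'
    · exact h (A.side_of_inc hb' hne).symm
    · exact h' (key b b' hb hb' (Ne.symm hne) _ h)

/-! ### The glued graph and separation by the ends of a block -/

/-- The graph glued along the tree from blocks, one for each edge `b`, each consisting of the two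
ends of `b` and the interior vertices `(b, b₁, i)`. An interior vertex with `b₁ ≠ b` misses only the
end of `b` towards `b₁`, the four interior vertices with `b₁ = b` miss one another in pairs. -/
def graph : SimpleGraph (C ⊕ L × L × Fin 4) where
  Adj
    | .inl _, .inl _ => False
    | .inl c, .inr (b, b₁, _) => A.Inc b c ∧ (b₁ = b ∨ A.toward b b₁ ≠ A.side b c)
    | .inr (b, b₁, _), .inl c => A.Inc b c ∧ (b₁ = b ∨ A.toward b b₁ ≠ A.side b c)
    | .inr (b, b₁, i), .inr (b', b₁', j) =>
        b = b' ∧ (b₁, i) ≠ (b₁', j) ∧ ¬ (b₁ = b ∧ b₁' = b ∧ j = i.rev)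
  symm := ⟨by
    rintro (c | ⟨b, b₁, i⟩) (c' | ⟨b', b₁', j⟩) h
    · exact h
    · exact h
    · exact h
    · obtain ⟨rfl, h, h'⟩ := h
      exact ⟨rfl, h.symm, fun ⟨h1, h2, h3⟩ => h' ⟨h2, h1, by rw [h3, Fin.rev_rev]⟩⟩⟩
  loopless := ⟨by
    rintro (c | ⟨b, b₁, i⟩) h
    · exact h
    · exact h.2.1 rfl⟩

lemma adj_inl_inl {c c' : C} : ¬ A.graph.Adj (.inl c) (.inl c') := fun h => h

/-- The interior vertices of the block of `b`. -/
def interior (b : L) : Set (C ⊕ L × L × Fin 4) := {x | ∃ p, x = .inr (b, p)}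

/-- The vertices of the block of `b`. -/
def block (b : L) : Set (C ⊕ L × L × Fin 4) :=
  {x | x ∈ interior b ∨ ∃ s, x = .inl (A.e b s)}

@[simp] lemma inl_notMem_interior {b : L} {c : C} : (.inl c : C ⊕ L × L × Fin 4) ∉ interior b := by
  rintro ⟨p, hp⟩; cases hp

@[simp] lemma inr_mem_interior {b b' : L} {p : L × Fin 4} :
    (.inr (b', p) : C ⊕ L × L × Fin 4) ∈ interior b ↔ b' = b := by
  constructor
  · rintro ⟨q, hq⟩; cases hq; rfl
  · rintro rfl; exact ⟨p, rfl⟩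

@[simp] lemma inl_mem_block {b : L} {c : C} : .inl c ∈ A.block b ↔ A.Inc b c := by
  constructor
  · rintro (h | ⟨s, hs⟩)
    · simp at h
    · cases hs; exact A.inc_e b s
  · intro h; exact Or.inr ⟨_, by rw [h]⟩

@[simp] lemma inr_mem_block {b b' : L} {p : L × Fin 4} :
    .inr (b', p) ∈ A.block b ↔ b' = b := by
  constructor
  · rintro (h | ⟨s, hs⟩)
    · simpa using h
    · cases hs
  · rintro rfl; exact Or.inl ⟨p, rfl⟩

lemma interior_subset_block (b : L) : interior b ⊆ A.block b := fun _ h => Or.inl h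

lemma exists_block_of_adj {x y : C ⊕ L × L × Fin 4} (h : A.graph.Adj x y) :
    ∃ b, x ∈ A.block b ∧ y ∈ A.block b ∧ (x ∈ interior b ∨ y ∈ interior b) := by
  rcases x with c | ⟨b, b₁, i⟩ <;> rcases y with c' | ⟨b', b₁', j⟩
  · exact (A.adj_inl_inl h).elim
  · exact ⟨b', by simpa using h.1, by simp, by simp⟩
  · exact ⟨b, by simp, by simpa using h.1, by simp⟩
  · obtain ⟨rfl, -⟩ := h
    exact ⟨b, by simp, by simp, by simp⟩

lemma eq_of_mem_interior {b b' : L} {x : C ⊕ L × L × Fin 4} (h : x ∈ interior b)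
    (h' : x ∈ A.block b') : b' = b := by
  obtain ⟨p, rfl⟩ := h
  exact (A.inr_mem_block.1 h').symm

lemma mem_block_of_adj {b : L} {x y : C ⊕ L × L × Fin 4} (hx : x ∈ interior b)
    (h : A.graph.Adj x y) : y ∈ A.block b := by
  obtain ⟨b', h1, h2, -⟩ := A.exists_block_of_adj h
  rwa [← A.eq_of_mem_interior hx h1]

/-- The side of `b` on which a vertex outside the interior of its block lies. -/
def sideOf (b : L) : C ⊕ L × L × Fin 4 → Bool
  | .inl c => A.side b c
  | .inr (b₁, _) => A.toward b b₁

/-- The vertices on the side `s` of `b`, outside the interior of its block. -/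
def region (b : L) (s : Bool) : Set (C ⊕ L × L × Fin 4) := {x | x ∉ interior b ∧ A.sideOf b x = s}

/-- Every block other than that of `b` lies entirely on one side of `b`. An edge leaving a region
therefore enters the interior of the block of `b`, which is attached to the region only at the end
on that side. -/
lemma eq_of_adj_region {b : L} {s : Bool} {x y : C ⊕ L × L × Fin 4} (hx : x ∈ A.region b s)
    (hy : y ∉ A.region b s) (h : A.graph.Adj x y) : x = .inl (A.e b s) := by
  obtain ⟨hx1, hx2⟩ := hx
  by_cases hyi : y ∈ interior b
  · rcases A.mem_block_of_adj hyi h.symm with hx | ⟨t, rfl⟩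
    · exact (hx1 hx).elim
    · simp only [sideOf, A.side_e] at hx2
      rw [hx2]
  · exfalso
    refine hy ⟨hyi, ?_⟩
    rw [← hx2]
    rcases x with c | ⟨b', b₁, i⟩ <;> rcases y with c' | ⟨b'', b₁', j⟩
    · exact (A.adj_inl_inl h).elim
    · exact (A.side_of_inc h.1 (by simpa using hyi)).symm
    · exact (A.side_of_inc h.1 (by simpa using hx1))
    · obtain ⟨rfl, -⟩ := h
      rfl

/-- A walk that leaves a side of `b` passes through the corresponding end of `b`. -/
lemma mem_of_reachable {b : L} {s : Bool} {S : Set (C ⊕ L × L × Fin 4)} {x y : S}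
    (h : (A.graph.induce S).Reachable x y) (hx : x.1 ∈ A.region b s) (hy : y.1 ∉ A.region b s) :
    .inl (A.e b s) ∈ S := by
  obtain ⟨p⟩ := h
  induction p with
  | nil => exact (hy hx).elim
  | @cons u v w huv _ ih =>
    by_cases hv : v.1 ∈ A.region b s
    · exact ih hv hy
    · rw [← A.eq_of_adj_region hx hv huv]; exact u.2

lemma interior_notMem_region {b : L} {s : Bool} {x : C ⊕ L × L × Fin 4} (hx : x ∈ interior b) :
    x ∉ A.region b s := fun h => h.1 hx

lemma mem_region {b : L} {x : C ⊕ L × L × Fin 4} (hx : x ∉ interior b) :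
    x ∈ A.region b (A.sideOf b x) := ⟨hx, rfl⟩

/-- A connected set that meets the interior of a block and contains neither end stays inside. -/
lemma subset_interior {b : L} {S : Set (C ⊕ L × L × Fin 4)} (hS : (A.graph.induce S).Connected)
    {x : C ⊕ L × L × Fin 4} (hx : x ∈ S) (hxb : x ∈ interior b) (he : ∀ s, .inl (A.e b s) ∉ S) :
    S ⊆ interior b := by
  intro y hy
  by_contra hyb
  exact he _ (A.mem_of_reachable (hS.preconnected ⟨y, hy⟩ ⟨x, hx⟩) (A.mem_region hyb)
    (A.interior_notMem_region hxb))

/-! ### Blocks and cut-vertices -/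

/-- The four interior vertices of the block of `b` that miss one another. -/
def core (b : L) (i : Fin 4) : C ⊕ L × L × Fin 4 := .inr (b, b, i)

lemma core_mem_interior (b : L) (i : Fin 4) : (core b i : C ⊕ L × L × Fin 4) ∈ interior b := by
  simp [core]

lemma core_mem_block (b : L) (i : Fin 4) : core b i ∈ A.block b := by
  simp [core]

lemma core_inj {b : L} {i j : Fin 4} : (core b i : C ⊕ L × L × Fin 4) = core b j ↔ i = j := by
  simp [core]

lemma core_adj {b : L} {i : Fin 4} {x : C ⊕ L × L × Fin 4} (hx : x ∈ A.block b)
    (h : x ≠ core b i) (h' : x ≠ core b i.rev) : A.graph.Adj (core b i) x := by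
  rcases x with c | ⟨b', b₁, j⟩
  · exact ⟨by simpa using hx, Or.inl rfl⟩
  · obtain rfl : b' = b := by simpa using hx
    refine ⟨rfl, fun h1 => h ?_, fun h1 => h' ?_⟩
    · rw [core, h1]
    · obtain ⟨-, rfl, rfl⟩ := h1
      rfl

lemma not_core_adj_rev (b : L) (i : Fin 4) : ¬ A.graph.Adj (core b i) (core b i.rev) :=
  fun h => h.2.2 ⟨rfl, rfl, rfl⟩

/-- Two adjacent core vertices dominate the block: the first sees everything but its partner, and
the second sees that partner. So any part of the block that keeps both is connected. -/
lemma connected_of_core {b : L} {S : Set (C ⊕ L × L × Fin 4)} (hS : S ⊆ A.block b) {i j : Fin 4}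
    (hi : core b i ∈ S) (hj : core b j ∈ S) (hij : j ≠ i) (hij' : j ≠ i.rev) :
    (A.graph.induce S).Connected := by
  have hadj : A.graph.Adj (core b i) (core b j) :=
    A.core_adj (A.core_mem_block b j) (by rwa [Ne, core_inj]) (by rwa [Ne, core_inj])
  have key : ∀ x : S, (A.graph.induce S).Reachable ⟨core b i, hi⟩ x := by
    rintro ⟨x, hx⟩
    by_cases h : x = core b i
    · subst h; rfl
    by_cases h' : x = core b i.rev
    · have h1 : (A.graph.induce S).Adj ⟨core b i, hi⟩ ⟨core b j, hj⟩ := hadj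
      have h2 : (A.graph.induce S).Adj ⟨core b j, hj⟩ ⟨x, hx⟩ := by
        refine A.core_adj (hS hx) ?_ ?_
        · change x ≠ _
          rw [h', Ne, core_inj]; exact hij'.symm
        · change x ≠ _
          rw [h', Ne, core_inj, Fin.rev_inj]; exact hij.symm
      exact h1.reachable.trans h2.reachable
    · have h1 : (A.graph.induce S).Adj ⟨core b i, hi⟩ ⟨x, hx⟩ := A.core_adj (hS hx) h h'
      exact h1.reachable
  have : Nonempty S := ⟨⟨_, hi⟩⟩
  exact ⟨fun x y => (key x).symm.trans (key y)⟩

lemma block_diff_connected (b : L) (v : C ⊕ L × L × Fin 4) :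
    (A.graph.induce (A.block b \ {v})).Connected := by
  -- Deleting one vertex spares one of the adjacent pairs formed by core vertices `0, 1` and `2, 3`.
  by_cases h : v = core b 0 ∨ v = core b 1
  · refine A.connected_of_core (b := b) (i := 2) (j := 3) Set.sdiff_subset
      ⟨A.core_mem_block _ _, ?_⟩ ⟨A.core_mem_block _ _, ?_⟩ (by decide) (by decide) <;>
    · rcases h with rfl | rfl <;> simp [core_inj]
  · push Not at h
    exact A.connected_of_core (b := b) (i := 0) (j := 1) Set.sdiff_subset
      ⟨A.core_mem_block _ _, h.1.symm⟩ ⟨A.core_mem_block _ _, h.2.symm⟩ (by decide) (by decide)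

lemma block_connected (b : L) : (A.graph.induce (A.block b)).Connected :=
  A.connected_of_core (b := b) (i := 0) (j := 1) subset_rfl
    (A.core_mem_block _ _) (A.core_mem_block _ _) (by decide) (by decide)

lemma block_isTwoConnectedOn (b : L) : A.graph.IsTwoConnectedOn (A.block b) := by
  refine ⟨?_, A.block_connected b, fun v _ => A.block_diff_connected b v⟩
  have h : ({core b 0, core b 1, core b 2} : Set (C ⊕ L × L × Fin 4)).encard = 3 := by
    rw [Set.encard_eq_three]
    exact ⟨_, _, _, by simp [core_inj], by simp [core_inj], by simp [core_inj], rfl⟩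
  rw [← h]
  refine Set.encard_le_encard ?_
  rintro x (rfl | rfl | rfl) <;> exact A.core_mem_block _ _

/-- Puts every edge in a triangle, so that no edge is a bridge. Core vertex `0` or `1` serves unless
`u` and `v` hit both missing pairs `{0, 3}` and `{1, 2}`; then both are core vertices, and an end of
`b` sees all of these. -/
lemma exists_common_neighbor {b : L} {u v : C ⊕ L × L × Fin 4} (hu : u ∈ A.block b)
    (hv : v ∈ A.block b) : ∃ w, A.graph.Adj w u ∧ A.graph.Adj w v := by
  by_cases h0 : u ≠ core b 0 ∧ u ≠ core b 3 ∧ v ≠ core b 0 ∧ v ≠ core b 3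
  · exact ⟨core b 0, A.core_adj hu h0.1 h0.2.1, A.core_adj hv h0.2.2.1 h0.2.2.2⟩
  by_cases h1 : u ≠ core b 1 ∧ u ≠ core b 2 ∧ v ≠ core b 1 ∧ v ≠ core b 2
  · exact ⟨core b 1, A.core_adj hu h1.1 h1.2.1, A.core_adj hv h1.2.2.1 h1.2.2.2⟩
  have h : (∃ i, u = core b i) ∧ ∃ j, v = core b j := by
    by_cases hu' : ∃ i, u = core b i
    · obtain ⟨i, rfl⟩ := hu'
      refine ⟨⟨i, rfl⟩, ?_⟩
      by_contra! hv'
      simp only [Ne, core_inj] at h0 h1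
      have := hv' 0; have := hv' 1; have := hv' 2; have := hv' 3
      fin_cases i <;> simp_all
    · push Not at hu'
      have := hu' 0; have := hu' 1; have := hu' 2; have := hu' 3
      by_cases hv' : ∃ j, v = core b j
      · obtain ⟨j, rfl⟩ := hv'
        simp only [Ne, core_inj] at h0 h1
        fin_cases j <;> simp_all
      · push Not at hv'
        exact (h0 ⟨hu' 0, hu' 3, hv' 0, hv' 3⟩).elim
  obtain ⟨⟨i, rfl⟩, j, rfl⟩ := h
  exact ⟨.inl (A.e b true), ⟨A.inc_e _ _, Or.inl rfl⟩, ⟨A.inc_e _ _, Or.inl rfl⟩⟩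

lemma not_isBridge {u v : C ⊕ L × L × Fin 4} (h : A.graph.Adj u v) :
    ¬ A.graph.IsBridge s(u, v) := by
  obtain ⟨b, hu, hv, -⟩ := A.exists_block_of_adj h
  obtain ⟨w, hwu, hwv⟩ := A.exists_common_neighbor hu hv
  rw [SimpleGraph.isBridge_iff, not_not]
  have h1 : (A.graph.deleteEdges {s(u, v)}).Adj u w := by
    rw [SimpleGraph.deleteEdges_adj]
    refine ⟨hwu.symm, ?_⟩
    have := hwv.ne
    simp only [Set.mem_singleton_iff, Sym2.eq_iff]
    rintro (⟨-, rfl⟩ | ⟨rfl, rfl⟩)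
    · exact this rfl
    · exact h.ne rfl
  have h2 : (A.graph.deleteEdges {s(u, v)}).Adj w v := by
    rw [SimpleGraph.deleteEdges_adj]
    refine ⟨hwv, ?_⟩
    have := hwu.ne
    simp only [Set.mem_singleton_iff, Sym2.eq_iff]
    rintro (⟨rfl, -⟩ | ⟨rfl, rfl⟩)
    · exact this rfl
    · exact h.ne rfl
  exact h1.reachable.trans h2.reachable

/-- Some edge of `S` has an endpoint in the interior of a block. If `S` also left that block, every
path outwards would use the same end, whose deletion would then disconnect `S`. -/
lemma exists_subset_block {S : Set (C ⊕ L × L × Fin 4)} (hS : A.graph.IsTwoConnectedOn S) :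
    ∃ b, S ⊆ A.block b := by
  obtain ⟨hcard, hconn, hdel⟩ := hS
  have hnt : S.Nontrivial := by
    rw [← Set.one_lt_encard_iff_nontrivial]
    exact lt_of_lt_of_le (by norm_num) hcard
  have : Nontrivial S := hnt.coe_sort
  obtain ⟨x, b, hx, hxb⟩ : ∃ x b, x ∈ S ∧ x ∈ interior b := by
    obtain ⟨v⟩ := hconn.nonempty
    obtain ⟨w, hw⟩ := hconn.preconnected.exists_adj_of_nontrivial v
    obtain ⟨b, -, -, h | h⟩ := A.exists_block_of_adj (x := v.1) (y := w.1) hw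
    · exact ⟨_, b, v.2, h⟩
    · exact ⟨_, b, w.2, h⟩
  refine ⟨b, fun z hz => ?_⟩
  by_contra hzb
  have hzr := A.mem_region (fun h => hzb (A.interior_subset_block b h))
  have hxr := A.interior_notMem_region (s := A.sideOf b z) hxb
  have hc : .inl (A.e b (A.sideOf b z)) ∈ S :=
    A.mem_of_reachable (hconn.preconnected ⟨z, hz⟩ ⟨x, hx⟩) hzr hxr
  refine (A.mem_of_reachable (S := S \ {.inl (A.e b (A.sideOf b z))})
    ((hdel _ hc).preconnected ⟨z, hz, ?_⟩ ⟨x, hx, ?_⟩) hzr hxr).2 rfl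
  · rintro h
    rw [Set.mem_singleton_iff] at h
    exact hzb (Or.inr ⟨_, h⟩)
  · rintro h
    rw [Set.mem_singleton_iff] at h
    exact inl_notMem_interior (h ▸ hxb)

lemma eq_of_block_subset {b b' : L} (h : A.block b ⊆ A.block b') : b = b' :=
  (A.eq_of_mem_interior (core_mem_interior b 0) (h (A.core_mem_block b 0))).symm

lemma isBlock_iff {S : Set (C ⊕ L × L × Fin 4)} : A.graph.IsBlock S ↔ ∃ b, S = A.block b := by
  constructor
  · rintro (⟨u, v, h, hb, -⟩ | h)
    · exact (A.not_isBridge h hb).elim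
    · obtain ⟨b, hb⟩ := A.exists_subset_block h.prop
      exact ⟨b, hb.antisymm (h.le_of_ge (A.block_isTwoConnectedOn b) hb)⟩
  · rintro ⟨b, rfl⟩
    refine Or.inr ⟨A.block_isTwoConnectedOn b, fun S hS hb => ?_⟩
    obtain ⟨b', hb'⟩ := A.exists_subset_block hS
    obtain rfl := A.eq_of_block_subset (hb.trans hb')
    exact hb'

lemma reachable_of_subset {V : Type*} {G : SimpleGraph V} {S S' : Set V} (h : S ⊆ S')
    (hS : (G.induce S).Connected) {x y : V} (hx : x ∈ S) (hy : y ∈ S) :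
    (G.induce S').Reachable ⟨x, h hx⟩ ⟨y, h hy⟩ :=
  (hS.preconnected ⟨x, hx⟩ ⟨y, hy⟩).map (SimpleGraph.induceHomOfLE G h).toHom

/-- Deleting a vertex of a single block leaves the graph connected. -/
lemma reachable_compl {b₀ : L} {v : C ⊕ L × L × Fin 4} (hv : ∀ b, v ∈ A.block b → b = b₀)
    (x y : ({v}ᶜ : Set (C ⊕ L × L × Fin 4))) : (A.graph.induce {v}ᶜ).Reachable x y := by
  obtain ⟨r, hr, hrv⟩ : ∃ r ∈ A.block b₀, r ≠ v := by
    obtain ⟨⟨r, hr⟩⟩ := (A.block_diff_connected b₀ v).nonempty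
    exact ⟨r, hr.1, hr.2⟩
  have hsub : A.block b₀ \ {v} ⊆ {v}ᶜ := fun z hz => hz.2
  have hb₀ : ∀ z (hz : z ≠ v), z ∈ A.block b₀ →
      (A.graph.induce {v}ᶜ).Reachable ⟨z, hz⟩ ⟨r, hrv⟩ := fun z hz hzb =>
    reachable_of_subset hsub (A.block_diff_connected b₀ v) ⟨hzb, hz⟩ ⟨hr, hrv⟩
  have hb : ∀ b, b ≠ b₀ → ∀ z w, z ∈ A.block b → w ∈ A.block b → ∃ hz hw,
      (A.graph.induce {v}ᶜ).Reachable ⟨z, hz⟩ ⟨w, hw⟩ := fun b hb z w hz hw => by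
    have hs : A.block b ⊆ {v}ᶜ := by
      rintro x hx rfl
      exact hb (hv b hx)
    exact ⟨_, _, reachable_of_subset hs (A.block_connected b) hz hw⟩
  have hC : ∀ c, ∀ h : .inl c ≠ v, (A.graph.induce {v}ᶜ).Reachable ⟨.inl c, h⟩ ⟨r, hrv⟩ := by
    intro c
    refine A.conn (fun c => ∀ h : .inl c ≠ v, (A.graph.induce {v}ᶜ).Reachable ⟨.inl c, h⟩ ⟨r, hrv⟩)
      ?_ (A.e b₀ true) c fun h => hb₀ _ h (Or.inr ⟨_, rfl⟩)
    intro b s t hs ht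
    by_cases h : b = b₀
    · subst h
      exact hb₀ _ ht (Or.inr ⟨_, rfl⟩)
    · obtain ⟨h1, h2, h3⟩ := hb b h _ _ (Or.inr ⟨t, rfl⟩) (Or.inr ⟨s, rfl⟩)
      exact h3.trans (hs h2)
  have key : ∀ z, (A.graph.induce {v}ᶜ).Reachable z ⟨r, hrv⟩ := by
    rintro ⟨c | ⟨b, p⟩, hz⟩
    · exact hC c hz
    · by_cases h : b = b₀
      · subst h
        exact hb₀ _ hz (by simp)
      · obtain ⟨h1, h2, h3⟩ := hb b h (.inr (b, p)) _ (by simp) (Or.inr ⟨true, rfl⟩)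
        exact h3.trans (hC _ h2)
  exact (key x).trans (key y).symm

lemma graph_connected [Nonempty L] : A.graph.Connected := by
  obtain ⟨b₀⟩ := ‹Nonempty L›
  have hb : ∀ b x y, x ∈ A.block b → y ∈ A.block b → A.graph.Reachable x y := fun b x y hx hy =>
    ((A.block_connected b).preconnected ⟨x, hx⟩ ⟨y, hy⟩).map
      (SimpleGraph.Embedding.induce (G := A.graph) (A.block b)).toHom
  have hC : ∀ c, A.graph.Reachable (.inl c) (.inl (A.e b₀ true)) := fun c =>
    A.conn (fun c => A.graph.Reachable (.inl c) (.inl (A.e b₀ true)))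
      (fun b s t hs => (hb b _ _ (Or.inr ⟨t, rfl⟩) (Or.inr ⟨s, rfl⟩)).trans hs) (A.e b₀ true) c
      (by rfl)
  have key : ∀ z, A.graph.Reachable z (.inl (A.e b₀ true)) := by
    rintro (c | ⟨b, p⟩)
    · exact hC c
    · exact (hb b _ _ (by simp) (Or.inr ⟨true, rfl⟩)).trans (hC _)
  have : Nonempty (C ⊕ L × L × Fin 4) := ⟨.inl (A.e b₀ true)⟩
  exact ⟨fun x y => (key x).trans (key y).symm⟩

/-- The cut-vertices are the vertices that lie in two blocks. -/
lemma isCutVertex_iff {v : C ⊕ L × L × Fin 4} :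
    A.graph.IsCutVertex v ↔ ∃ c, v = .inl c ∧ ∃ b b', b ≠ b' ∧ A.Inc b c ∧ A.Inc b' c := by
  constructor
  · rintro ⟨x, y, hx, hy, -, h⟩
    by_contra! hv
    refine h ?_
    rcases v with c | ⟨b, p⟩
    · have := hv c rfl
      by_cases hb : ∃ b₀, A.Inc b₀ c
      · obtain ⟨b₀, hb₀⟩ := hb
        refine A.reachable_compl (b₀ := b₀) (fun b hb => ?_) _ _
        by_contra hne
        exact this b b₀ hne (by simpa using hb) hb₀
      -- If no edge meets `c`, no block contains it and any edge serves as `b₀`; one exists because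
      -- `x` is a vertex other than `c`.
      · obtain ⟨b₀⟩ : Nonempty L := by
          rcases x with c' | ⟨b, -⟩
          · have hcc' : c' ≠ c := fun h => hx (by rw [h]; rfl)
            exact ⟨(A.exists_inc_side_ne hcc').choose⟩
          · exact ⟨b⟩
        exact A.reachable_compl (b₀ := b₀)
          (fun b h => (hb ⟨b, by simpa using h⟩).elim) _ _
    · exact A.reachable_compl (b₀ := b) (fun b' hb => (by simpa using hb : b = b').symm) _ _
  · rintro ⟨c, rfl, b, b', hne, hb, hb'⟩
    have : Nonempty L := ⟨b⟩
    -- From the block of `b'` the interior of the block of `b` is reached only through the end of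
    -- `b` on that side, which is `c`.
    refine ⟨core b' 0, core b 0, by simp [core], by simp [core],
      A.graph_connected.preconnected _ _, fun h => ?_⟩
    have h1 : (core b' 0 : C ⊕ L × L × Fin 4) ∈ A.region b (A.side b c) := by
      refine ⟨?_, (A.side_of_inc hb' hne.symm).symm⟩
      simpa [core] using hne.symm
    have h2 := A.mem_of_reachable h h1 (A.interior_notMem_region (core_mem_interior b 0))
    refine h2 ?_
    rw [hb]; rfl

/-! ### Regularity -/

open Classical in
/-- A quarter of the degree of the end `e b s` in the block of `b`. -/
noncomputable def weight [Fintype L] (b : L) (s : Bool) : ℕ :=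
  (Finset.univ.filter fun b₁ => b₁ = b ∨ A.toward b b₁ ≠ s).card

lemma weight_pos [Fintype L] (b : L) (s : Bool) : 0 < A.weight b s :=
  Finset.card_pos.2 ⟨b, by simp⟩

/-- Each edge other than `b` is counted at exactly one end, and `b` itself at both. -/
lemma weight_add [Fintype L] (b : L) : A.weight b true + A.weight b false = Fintype.card L + 1 := by
  classical
  unfold weight
  rw [← Finset.card_union_add_card_inter]
  congr 1
  · rw [← Finset.card_univ]
    congr 1
    ext b₁
    cases h : A.toward b b₁ <;> simp [h]
  · rw [Finset.card_eq_one]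
    refine ⟨b, ?_⟩
    ext b₁
    cases h : A.toward b b₁ <;> simp [h]

open Classical in
-- Double counting: by `existsUnique_toward`, each edge `b₁` contributes to the weight of exactly
-- one edge at `c`.
lemma sum_weight [Fintype L] (c : C) :
    ∑ b, (if A.Inc b c then A.weight b (A.side b c) else 0) = Fintype.card L := by
  have h : ∀ b, (if A.Inc b c then A.weight b (A.side b c) else 0) =
      ∑ b₁, if A.Inc b c ∧ (b₁ = b ∨ A.toward b b₁ ≠ A.side b c) then 1 else 0 := by
    intro b
    split_ifs with hb
    · simp [hb, weight]
    · simp [hb]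
  simp_rw [h]
  rw [Finset.sum_comm, ← Finset.card_univ, Finset.card_eq_sum_ones]
  refine Finset.sum_congr rfl fun b₁ _ => ?_
  rw [← Finset.card_filter, Finset.card_eq_one]
  obtain ⟨b, hb, hu⟩ := A.existsUnique_toward c b₁
  refine ⟨b, ?_⟩
  ext b'
  simp only [Finset.mem_filter, Finset.mem_univ, true_and, Finset.mem_singleton]
  exact ⟨fun h => hu b' h, fun h => h ▸ hb⟩

lemma ncard_block [Fintype L] [Finite C] (b : L) :
    (A.block b).ncard = 4 * Fintype.card L + 2 := by
  classical
  have h : A.block b = (Set.range fun p : L × Fin 4 => (.inr (b, p) : C ⊕ L × L × Fin 4)) ∪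
      Set.range fun s => .inl (A.e b s) := by
    ext x
    constructor
    · rintro (⟨p, rfl⟩ | ⟨s, rfl⟩)
      · exact Or.inl ⟨p, rfl⟩
      · exact Or.inr ⟨s, rfl⟩
    · rintro (⟨p, rfl⟩ | ⟨s, rfl⟩)
      · exact Or.inl ⟨p, rfl⟩
      · exact Or.inr ⟨s, rfl⟩
  rw [h, Set.ncard_union_eq, ← Set.image_univ, ← Set.image_univ,
    Set.ncard_image_of_injective, Set.ncard_image_of_injective, Set.ncard_univ, Set.ncard_univ]
  · simp [mul_comm]
  · intro s t h
    exact A.e_injective b (Sum.inl_injective h)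
  · intro p q h
    simpa using h
  · rw [Set.disjoint_left]
    rintro _ ⟨p, rfl⟩ ⟨s, hs⟩
    cases hs

/-- An interior vertex is adjacent to all vertices of its block except itself and one other. -/
lemma exists_missed (b : L) (p : L × Fin 4) : ∃ y ∈ A.block b, y ≠ .inr (b, p) ∧
    ∀ z, A.graph.Adj (.inr (b, p)) z ↔ z ∈ A.block b ∧ z ≠ .inr (b, p) ∧ z ≠ y := by
  obtain ⟨b₁, i⟩ := p
  by_cases h : b₁ = b
  · subst h
    refine ⟨core b₁ i.rev, A.core_mem_block _ _, ?_, fun z => ⟨fun hz => ⟨?_, hz.ne', ?_⟩, ?_⟩⟩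
    · change core b₁ i.rev ≠ core b₁ i
      rw [Ne, core_inj]
      fin_cases i <;> decide
    · exact A.mem_block_of_adj (core_mem_interior b₁ i) hz
    · rintro rfl
      exact A.not_core_adj_rev b₁ i hz
    · rintro ⟨h1, h2, h3⟩
      exact A.core_adj h1 h2 h3
  · refine ⟨.inl (A.e b (A.toward b b₁)), Or.inr ⟨_, rfl⟩, by simp,
      fun z => ⟨fun hz => ⟨?_, hz.ne', ?_⟩, ?_⟩⟩
    · exact A.mem_block_of_adj (b := b) (by simp) hz
    · rintro rfl
      rcases hz.2 with h' | h'
      · exact h h'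
      · rw [A.side_e] at h'
        exact h' rfl
    · rintro ⟨h1, h2, h3⟩
      rcases z with c | ⟨b', b₁', j⟩
      · have hc : A.Inc b c := by simpa using h1
        refine ⟨hc, Or.inr fun h' => h3 ?_⟩
        rw [h', hc]
      · obtain rfl : b' = b := by simpa using h1
        exact ⟨rfl, fun h' => h2 (by rw [h']), fun h' => h h'.1⟩

lemma ncard_neighborSet_inter [Fintype L] [Finite C] (b : L) (s : Bool) :
    {y | y ∈ A.block b ∧ A.graph.Adj (.inl (A.e b s)) y}.ncard = 4 * A.weight b s := by
  classical
  have h : {y | y ∈ A.block b ∧ A.graph.Adj (.inl (A.e b s)) y} =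
      ((fun p => .inr (b, p)) '' (((Finset.univ.filter fun b₁ => b₁ = b ∨ A.toward b b₁ ≠ s) ×ˢ
        (Finset.univ : Finset (Fin 4)) : Finset (L × Fin 4)) : Set (L × Fin 4))) := by
    ext y
    constructor
    · rintro ⟨hy, hadj⟩
      rcases y with c | ⟨b', b₁, i⟩
      · exact (A.adj_inl_inl hadj).elim
      · obtain rfl : b' = b := by simpa using hy
        have := hadj.2
        rw [A.side_e] at this
        exact ⟨(b₁, i), by simpa using this, rfl⟩
    · rintro ⟨⟨b₁, i⟩, hp, rfl⟩
      refine ⟨by simp, A.inc_e b s, ?_⟩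
      rw [A.side_e]
      simpa using hp
  rw [h, Set.ncard_image_of_injective, Set.ncard_coe_finset, Finset.card_product, weight]
  · simp [mul_comm]
  · intro p q h
    simpa using h

/-- At an end, the neighbourhoods in different blocks are disjoint and `sum_weight` adds them up. An
interior vertex sees its block of `4 * card L + 2` vertices except itself and the missed one. -/
lemma ncard_neighborSet [Fintype L] [Finite C] (x : C ⊕ L × L × Fin 4) :
    (A.graph.neighborSet x).ncard = 4 * Fintype.card L := by
  classical
  rcases x with c | ⟨b, p⟩
  · have h : A.graph.neighborSet (.inl c) =
        ⋃ b, {y | A.Inc b c ∧ y ∈ A.block b ∧ A.graph.Adj (.inl c) y} := by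
      ext y
      rw [SimpleGraph.mem_neighborSet, Set.mem_iUnion]
      constructor
      · intro h
        obtain ⟨b, h1, h2, -⟩ := A.exists_block_of_adj h
        exact ⟨b, by simpa using h1, h2, h⟩
      · rintro ⟨b, -, -, h⟩
        exact h
    rw [h, Set.ncard_iUnion_of_finite (fun _ => Set.toFinite _), finsum_eq_sum_of_fintype,
      ← A.sum_weight c, Finset.mul_sum]
    · refine Finset.sum_congr rfl fun b _ => ?_
      split_ifs with hb
      · rw [← A.ncard_neighborSet_inter, hb]
        simp [hb]
      · simp [hb]
    · intro b b' hne
      rw [Function.onFun, Set.disjoint_left]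
      rintro y ⟨-, hy, h⟩ ⟨-, hy', -⟩
      rcases y with c' | ⟨b'', p⟩
      · exact A.adj_inl_inl h
      · exact hne ((A.inr_mem_block.1 hy).symm.trans (A.inr_mem_block.1 hy'))
  · obtain ⟨y, hy, hne, h⟩ := A.exists_missed b p
    have h : A.graph.neighborSet (.inr (b, p)) = (A.block b \ {.inr (b, p)}) \ {y} := by
      ext z
      rw [SimpleGraph.mem_neighborSet, h]
      simp [and_assoc]
    have hy' : y ∈ A.block b \ {.inr (b, p)} := ⟨hy, hne⟩
    rw [h, Set.ncard_sdiff_singleton_of_mem hy', Set.ncard_sdiff_singleton_of_mem (by simp),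
      A.ncard_block]
    rfl

/-! ### Rigidity inside a block -/

/-- Every vertex of the block of `b` lies in a branch set that contains no other vertex of it. -/
def Discrete {W : Type*} (B : W → Set (C ⊕ L × L × Fin 4)) (b : L) : Prop :=
  ∀ x ∈ A.block b, ∃ w, x ∈ B w ∧ ∀ y ∈ A.block b, y ∈ B w → y = x

lemma eq_of_mem {V W : Type*} {B : W → Set V} (hdisj : ∀ w w', w ≠ w' → Disjoint (B w) (B w'))
    {w w' : W} {x : V} (h : x ∈ B w) (h' : x ∈ B w') : w = w' := by
  by_contra hne
  exact Set.disjoint_left.1 (hdisj w w' hne) h h'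

/-- Two points cannot meet three pairwise disjoint pairs. -/
lemma not_inter_pair {V : Type*} {p₁ q₁ p₂ q₂ p₃ q₃ : V} (h₁₂ : p₁ ≠ p₂) (h₁₂' : p₁ ≠ q₂)
    (h₂₁ : q₁ ≠ p₂) (h₂₁' : q₁ ≠ q₂) (h₁₃ : p₁ ≠ p₃) (h₁₃' : p₁ ≠ q₃) (h₃₁ : q₁ ≠ p₃)
    (h₃₁' : q₁ ≠ q₃) (h₂₃ : p₂ ≠ p₃) (h₂₃' : p₂ ≠ q₃) (h₃₂ : q₂ ≠ p₃) (h₃₂' : q₂ ≠ q₃) (u z : V) :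
    (p₁ ≠ u ∧ p₁ ≠ z ∧ q₁ ≠ u ∧ q₁ ≠ z) ∨ (p₂ ≠ u ∧ p₂ ≠ z ∧ q₂ ≠ u ∧ q₂ ≠ z) ∨
      (p₃ ≠ u ∧ p₃ ≠ z ∧ q₃ ≠ u ∧ q₃ ≠ z) := by
  grind

/-- Among any branch sets of a minor of minimum degree at least that of the graph, if one lies in
the interior of a block, then the block is not contracted at all. -/
lemma discrete_of_subset_interior [Fintype L] [Nontrivial L] [Finite C] {W : Type*} [Finite W]
    {K : SimpleGraph W} {B : W → Set (C ⊕ L × L × Fin 4)}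
    (hconn : ∀ w, (A.graph.induce (B w)).Connected)
    (hdisj : ∀ w w', w ≠ w' → Disjoint (B w) (B w'))
    (hadj : ∀ w w', K.Adj w w' → ∃ x ∈ B w, ∃ y ∈ B w', A.graph.Adj x y)
    (hdeg : ∀ w, 4 * Fintype.card L ≤ (K.neighborSet w).ncard)
    {b : L} {w₀ : W} (hw₀ : B w₀ ⊆ interior b) : A.Discrete B b := by
  by_contra hnd
  simp only [Discrete, not_forall, not_exists, not_and] at hnd
  obtain ⟨u, hu, hnd⟩ := hnd
  set N : Set W := {w | (B w ∩ A.block b).Nonempty} with hN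
  have hmem : ∀ w, B w ⊆ interior b → w ∈ N := fun w hw => by
    obtain ⟨x, hx⟩ := (hconn w).nonempty
    exact ⟨x, hx, A.interior_subset_block b (hw hx)⟩
  have hnbr : ∀ w, B w ⊆ interior b → K.neighborSet w ⊆ N \ {w} := by
    intro w hw w' hww'
    obtain ⟨x, hx, y, hy, hxy⟩ := hadj w w' hww'
    exact ⟨⟨y, hy, A.mem_block_of_adj (hw hx) hxy⟩, hww'.ne'⟩
  -- The branch set `B w₀` and its neighbours, at least `4 * card L` in number, all meet the block.
  have hNcard : 4 * Fintype.card L + 1 ≤ N.ncard := by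
    have := (hdeg w₀).trans (Set.ncard_le_ncard (hnbr w₀ hw₀))
    rw [Set.ncard_sdiff_singleton_of_mem (hmem w₀ hw₀)] at this
    have := (Set.ncard_pos (Set.toFinite N)).2 ⟨w₀, hmem w₀ hw₀⟩
    omega
  -- Representatives in the block can avoid `u`: by the choice of `u`, a branch set containing it
  -- contains another vertex of the block. Only `4 * card L + 1` vertices are left, so the
  -- representatives exhaust them.
  have hf : ∀ w, ∃ y, w ∈ N → y ∈ B w ∧ y ∈ A.block b ∧ y ≠ u := by
    intro w
    by_cases hw : w ∈ N
    · by_cases huw : u ∈ B w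
      · obtain ⟨y, hy⟩ := hnd w huw
        push Not at hy
        exact ⟨y, fun _ => ⟨hy.2.1, hy.1, hy.2.2⟩⟩
      · obtain ⟨y, hy1, hy2⟩ := hw
        exact ⟨y, fun _ => ⟨hy1, hy2, fun h => huw (h ▸ hy1)⟩⟩
    · exact ⟨u, fun h => (hw h).elim⟩
  choose f hf using hf
  have hinj : Set.InjOn f N := fun w hw w' hw' h =>
    eq_of_mem hdisj (hf w hw).1 (h ▸ (hf w' hw').1)
  have hblock : (A.block b \ {u}).ncard = 4 * Fintype.card L + 1 := by
    rw [Set.ncard_sdiff_singleton_of_mem hu, A.ncard_block]; omega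
  have hsub : f '' N ⊆ A.block b \ {u} := by
    rintro _ ⟨w, hw, rfl⟩
    exact (hf w hw).2
  have himage : f '' N = A.block b \ {u} :=
    Set.eq_of_subset_of_ncard_le hsub (by rwa [hblock, hinj.ncard_image])
  have hNcard' : N.ncard = 4 * Fintype.card L + 1 := by
    rw [← hblock, ← himage, hinj.ncard_image]
  -- `z` represents the branch set containing `u`, with default `u` if there is none. All other
  -- vertices of the block are alone in their branch sets, within the block.
  obtain ⟨z, hz⟩ : ∃ z, ∀ w, u ∈ B w → f w = z := by
    by_cases h : ∃ w, u ∈ B w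
    · obtain ⟨w, hw⟩ := h
      exact ⟨f w, fun w' hw' => by rw [eq_of_mem hdisj hw' hw]⟩
    · exact ⟨u, fun w hw => (h ⟨w, hw⟩).elim⟩
  have hsingle : ∀ p ∈ A.block b, p ≠ u → p ≠ z →
      ∃ w ∈ N, p ∈ B w ∧ ∀ y ∈ A.block b, y ∈ B w → y = p := by
    intro p hp hpu hpz
    obtain ⟨w, hw, rfl⟩ : p ∈ f '' N := by rw [himage]; exact ⟨hp, hpu⟩
    refine ⟨w, hw, (hf w hw).1, fun y hy hyw => ?_⟩
    have hyu : y ≠ u := by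
      rintro rfl
      exact hpz (hz w hyw)
    obtain ⟨w', hw', rfl⟩ : y ∈ f '' N := by rw [himage]; exact ⟨hy, hyu⟩
    rw [eq_of_mem hdisj (hf w' hw').1 hyw]
  -- If a non-adjacent pair avoided `u` and `z`, the branch set of `p` would lie in the interior
  -- and, of the `4 * card L + 1` branch sets meeting the block, miss both itself and that of `q`:
  -- one neighbour too few.
  have hpair : ∀ p q, p ∈ interior b → q ∈ A.block b → p ≠ q → ¬ A.graph.Adj p q →
      ¬ (p ≠ u ∧ p ≠ z ∧ q ≠ u ∧ q ≠ z) := by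
    rintro p q hp hq hpq hnadj ⟨hpu, hpz, hqu, hqz⟩
    obtain ⟨w, hw, hpw, hp'⟩ := hsingle p (A.interior_subset_block b hp) hpu hpz
    obtain ⟨w', hw', hqw', hq'⟩ := hsingle q hq hqu hqz
    have hww' : w' ≠ w := by
      rintro rfl
      exact hpq (hq' p (A.interior_subset_block b hp) hpw)
    have hwi : B w ⊆ interior b := A.subset_interior (hconn w) hpw hp fun s hs =>
      inl_notMem_interior (hp' _ (Or.inr ⟨s, rfl⟩) hs ▸ hp)
    have hsub : K.neighborSet w ⊆ (N \ {w}) \ {w'} := by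
      intro w'' hw''
      refine ⟨hnbr w hwi hw'', ?_⟩
      rintro rfl
      obtain ⟨x, hx, y, hy, hxy⟩ := hadj w w'' hw''
      have hxi := hwi hx
      have hyb := A.mem_block_of_adj hxi hxy
      rw [hp' x (A.interior_subset_block b hxi) hx, hq' y hyb hy] at hxy
      exact hnadj hxy
    have := (hdeg w).trans (Set.ncard_le_ncard hsub)
    have hw'' : w' ∈ N \ {w} := ⟨hw', hww'⟩
    rw [Set.ncard_sdiff_singleton_of_mem hw'', Set.ncard_sdiff_singleton_of_mem hw, hNcard'] at this
    have := Fintype.card_pos (α := L)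
    omega
  -- The core yields only two disjoint non-adjacent pairs; a second edge supplies the third.
  obtain ⟨b₁, hb₁⟩ := exists_ne b
  have hmiss : ¬ A.graph.Adj (.inr (b, b₁, 0)) (.inl (A.e b (A.toward b b₁))) := by
    rintro ⟨-, h | h⟩
    · exact hb₁ h
    · rw [A.side_e] at h
      exact h rfl
  rcases not_inter_pair (p₁ := core b 0) (q₁ := core b 3) (p₂ := core b 1) (q₂ := core b 2)
    (p₃ := .inr (b, b₁, 0)) (q₃ := .inl (A.e b (A.toward b b₁))) (by simp [core]) (by simp [core])
    (by simp [core]) (by simp [core]) (by simp [core, hb₁.symm]) (by simp [core])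
    (by simp [core]) (by simp [core]) (by simp [core]) (by simp [core]) (by simp [core])
    (by simp [core]) u z with h | h | h
  · exact hpair _ _ (core_mem_interior b 0) (A.core_mem_block b 3) (by simp [core])
      (A.not_core_adj_rev b 0) h
  · exact hpair _ _ (core_mem_interior b 1) (A.core_mem_block b 2) (by simp [core])
      (A.not_core_adj_rev b 1) h
  · exact hpair _ _ (by simp) (Or.inr ⟨_, rfl⟩) (by simp) hmiss h

/-! ### Counting the neighbours of a branch set that contains ends -/

open Classical in
lemma sum_sum_weight [Fintype L] [Fintype C] (X : Finset C) :
    ∑ b, ∑ s, (if A.e b s ∈ X then 4 * A.weight b s else 0) = X.card * (4 * Fintype.card L) := by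
  have h : ∀ b, ∑ s, (if A.e b s ∈ X then 4 * A.weight b s else 0) =
      ∑ c ∈ X, 4 * if A.Inc b c then A.weight b (A.side b c) else 0 := by
    intro b
    have h' : ∀ c, (4 * if A.Inc b c then A.weight b (A.side b c) else 0) =
        ∑ s, if A.e b s = c then 4 * A.weight b s else 0 := by
      intro c
      by_cases hc : A.Inc b c
      · rw [if_pos hc, Finset.sum_eq_single_of_mem (A.side b c) (Finset.mem_univ _)]
        · exact (if_pos hc).symm
        · intro s _ hs
          rw [if_neg]
          rintro rfl
          exact hs (A.side_e b s).symm
      · rw [if_neg hc, mul_zero, Finset.sum_eq_zero]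
        intro s _
        rw [if_neg]
        rintro rfl
        exact hc (A.inc_e b s)
    simp_rw [h']
    rw [Finset.sum_comm]
    refine Finset.sum_congr rfl fun s _ => ?_
    rw [Finset.sum_ite_eq]
  simp_rw [h]
  rw [Finset.sum_comm]
  simp_rw [← Finset.mul_sum, A.sum_weight]
  simp [mul_left_comm]

open Classical in
/-- A connected set containing `k` of the ends contains both ends of at least `k - 1` edges. -/
lemma card_le_card_both [Fintype L] [Nonempty L] [Fintype C] {S : Set (C ⊕ L × L × Fin 4)}
    (hS : (A.graph.induce S).Connected) :
    (Finset.univ.filter fun c => .inl c ∈ S).card ≤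
      (Finset.univ.filter fun b => ∀ s, .inl (A.e b s) ∈ S).card + 1 := by
  by_cases h : ∃ c₀, .inl c₀ ∈ S
  · obtain ⟨c₀, hc₀⟩ := h
    rw [← Finset.card_erase_add_one (a := c₀) (by simpa using hc₀)]
    refine Nat.add_le_add_right ?_ 1
    -- Send `c` to the edge at `c` leading towards `c₀`. It separates the two, so `S` contains both
    -- its ends; and `c` is recovered as its end away from `c₀`, so the map is injective.
    have hg : ∀ c, ∃ b : L, c ≠ c₀ → A.Inc b c ∧ A.side b c₀ ≠ A.side b c := by
      intro c
      by_cases hc : c = c₀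
      · exact ⟨Classical.arbitrary L, fun h => (h hc).elim⟩
      · obtain ⟨b, hb⟩ := A.exists_inc_side_ne (Ne.symm hc)
        exact ⟨b, fun _ => hb⟩
    choose g hg using hg
    refine Finset.card_le_card_of_injOn g ?_ ?_
    · intro c hc
      simp only [Finset.coe_erase, Finset.coe_filter, Finset.mem_univ, true_and] at hc
      obtain ⟨h1, h2⟩ := hg c hc.2
      have hc' : .inl c ∈ S := hc.1
      have h3 := A.mem_of_reachable (b := g c) (s := A.side (g c) c₀)
        (hS.preconnected ⟨_, hc₀⟩ ⟨_, hc'⟩) ⟨by simp, rfl⟩ fun h => h2 h.2.symm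
      have h4 : Sum.inl (A.e (g c) (A.side (g c) c)) ∈ S := by rwa [h1]
      simp only [Finset.coe_filter, Finset.mem_univ, true_and]
      intro s
      by_cases hs : s = A.side (g c) c
      · rwa [hs]
      · have : s = A.side (g c) c₀ := by
          revert h2 hs
          cases s <;> cases A.side (g c) c <;> cases A.side (g c) c₀ <;> simp
        rwa [this]
    · intro c hc c' hc' h
      obtain ⟨h1, h1'⟩ := hg c (Finset.ne_of_mem_erase hc)
      obtain ⟨h2, h2'⟩ := hg c' (Finset.ne_of_mem_erase hc')
      rw [h] at h1 h1'
      have h3 : A.side (g c') c = A.side (g c') c' := by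
        revert h1' h2'
        generalize A.side (g c') c = s₁
        generalize A.side (g c') c' = s₂
        generalize A.side (g c') c₀ = s₀
        cases s₁ <;> cases s₂ <;> cases s₀ <;> simp
      have h4 : A.e (g c') (A.side (g c') c) = c := h1
      rw [← h4, h3]
      exact h2
  · have : (Finset.univ.filter fun c => (.inl c : C ⊕ L × L × Fin 4) ∈ S) = ∅ := by
      ext c; simp only [Finset.mem_filter, Finset.mem_univ, true_and]
      exact ⟨fun hc => (h ⟨c, hc⟩).elim, by simp⟩
    rw [this]
    simp

section Minor

variable [Fintype L] [Nontrivial L] [Finite C] {W : Type*} [Finite W] {K : SimpleGraph W}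
  {B : W → Set (C ⊕ L × L × Fin 4)}

/-- A connected set that meets the block and avoids both ends lies in the interior, which
`discrete_of_subset_interior` forbids. -/
lemma exists_end_mem_of_not_discrete
    (hconn : ∀ w, (A.graph.induce (B w)).Connected)
    (hdisj : ∀ w w', w ≠ w' → Disjoint (B w) (B w'))
    (hadj : ∀ w w', K.Adj w w' → ∃ x ∈ B w, ∃ y ∈ B w', A.graph.Adj x y)
    (hdeg : ∀ w, 4 * Fintype.card L ≤ (K.neighborSet w).ncard)
    {b : L} (hb : ¬ A.Discrete B b) {w : W} {y : C ⊕ L × L × Fin 4} (hy : y ∈ B w)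
    (hyb : y ∈ A.block b) : ∃ t, .inl (A.e b t) ∈ B w := by
  by_contra! h
  rcases hyb with hyi | ⟨t, rfl⟩
  · exact hb (A.discrete_of_subset_interior hconn hdisj hadj hdeg
      (A.subset_interior (hconn w) hy hyi h))
  · exact h t hy

open Classical in
/-- The number of neighbours in the minor that a branch set has across the block of `b`. -/
lemma ncard_neighbors_across_le
    (hconn : ∀ w, (A.graph.induce (B w)).Connected)
    (hdisj : ∀ w w', w ≠ w' → Disjoint (B w) (B w'))
    (hadj : ∀ w w', K.Adj w w' → ∃ x ∈ B w, ∃ y ∈ B w', A.graph.Adj x y)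
    (hdeg : ∀ w, 4 * Fintype.card L ≤ (K.neighborSet w).ncard)
    {w : W} {c : C} (hc : .inl c ∈ B w) (b : L) :
    {w' | K.Adj w w' ∧ ∃ x ∈ B w, ∃ y ∈ B w', A.graph.Adj x y ∧ x ∈ A.block b ∧
        y ∈ A.block b}.ncard +
      (if ∀ s, .inl (A.e b s) ∈ B w then 4 * Fintype.card L + 4 else 0) +
      (if (∃ s, .inl (A.e b s) ∈ B w) ∧ (¬ ∀ s, .inl (A.e b s) ∈ B w) ∧ ¬ A.Discrete B b
        then 1 else 0) ≤
    ∑ s, if .inl (A.e b s) ∈ B w then 4 * A.weight b s else 0 := by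
  set N := {w' | K.Adj w w' ∧ ∃ x ∈ B w, ∃ y ∈ B w', A.graph.Adj x y ∧ x ∈ A.block b ∧
        y ∈ A.block b} with hN
  -- With both ends in `B w` the block is not discrete, so every branch set meeting it contains an
  -- end and equals `B w`. There is no neighbour across the block, and the ends' combined degree `4
  -- * card L + 4` is lost.
  by_cases hboth : ∀ s, .inl (A.e b s) ∈ B w
  · have hnd : ¬ A.Discrete B b := by
      intro h
      obtain ⟨w', h1, h2⟩ := h (.inl (A.e b true)) (Or.inr ⟨_, rfl⟩)
      obtain rfl := eq_of_mem hdisj h1 (hboth true)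
      have := A.e_injective b (Sum.inl_injective (h2 _ (Or.inr ⟨_, rfl⟩) (hboth false)))
      cases this
    have hempty : N = ∅ := by
      ext w'
      simp only [Set.mem_empty_iff_false, iff_false]
      rintro ⟨hw', x, -, y, hy, -, -, hyb⟩
      obtain ⟨t, ht⟩ := A.exists_end_mem_of_not_discrete hconn hdisj hadj hdeg hnd hy hyb
      exact hw'.ne (eq_of_mem hdisj (hboth t) ht)
    have := A.weight_add b
    simp only [hempty, hboth, Fintype.sum_bool]
    simp
    omega
  by_cases hsome : ∃ s, .inl (A.e b s) ∈ B w
  · obtain ⟨s, hs⟩ := hsome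
    have hs' : .inl (A.e b (!s)) ∉ B w := by
      intro h
      refine hboth fun t => ?_
      rcases Bool.eq_or_eq_not t s with rfl | rfl <;> assumption
    have hsum : (∑ s, if .inl (A.e b s) ∈ B w then 4 * A.weight b s else 0) = 4 * A.weight b s := by
      rw [Finset.sum_eq_single_of_mem s (Finset.mem_univ _), if_pos hs]
      intro t _ ht
      rw [if_neg]
      rwa [Bool.eq_not_of_ne ht]
    rw [hsum, if_neg hboth]
    by_cases hd : A.Discrete B b
    · rw [if_neg (by tauto), ← A.ncard_neighborSet_inter b s]
      have hch : ∀ w', ∃ y, w' ∈ N → y ∈ B w' ∧ y ∈ A.block b ∧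
          A.graph.Adj (.inl (A.e b s)) y := by
        intro w'
        by_cases hw' : w' ∈ N
        · obtain ⟨-, x, hx, y, hy, hxy, hxb, hyb⟩ := hw'
          obtain ⟨w₁, h1, h2⟩ := hd x hxb
          obtain rfl := eq_of_mem hdisj hx h1
          rw [← h2 _ (Or.inr ⟨_, rfl⟩) hs] at hxy
          exact ⟨y, fun _ => ⟨hy, hyb, hxy⟩⟩
        · exact ⟨.inl c, fun h => (hw' h).elim⟩
      choose f hf using hch
      have hinj : Set.InjOn f N := fun w₁ h₁ w₂ h₂ h =>
        eq_of_mem hdisj (hf w₁ h₁).1 (h ▸ (hf w₂ h₂).1)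
      rw [← hinj.ncard_image]
      refine Set.ncard_le_ncard ?_
      rintro _ ⟨w', hw', rfl⟩
      exact (hf w' hw').2
    -- Only the branch set containing the other end can be a neighbour across this block, while the
    -- allowance is at least `4`.
    · have : N.ncard ≤ 1 := by
        rw [Set.ncard_le_one_iff]
        have hN' : ∀ w' ∈ N, .inl (A.e b (!s)) ∈ B w' := by
          rintro w' ⟨hw', x, -, y, hy, -, -, hyb⟩
          obtain ⟨t, ht⟩ := A.exists_end_mem_of_not_discrete hconn hdisj hadj hdeg hd hy hyb
          rcases Bool.eq_or_eq_not t s with rfl | rfl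
          · exact (hw'.ne (eq_of_mem hdisj hs ht)).elim
          · exact ht
        exact fun _ _ h1 h2 => eq_of_mem hdisj (hN' _ h1) (hN' _ h2)
      have := A.weight_pos b s
      split_ifs <;> omega
  · have hempty : N = ∅ := by
      ext w'
      simp only [Set.mem_empty_iff_false, iff_false]
      rintro ⟨-, x, hx, y, -, -, hxb, -⟩
      rcases hxb with hxi | ⟨s, rfl⟩
      · exact inl_notMem_interior
          (A.subset_interior (hconn w) hx hxi (fun s hs => hsome ⟨s, hs⟩) hc)
      · exact hsome ⟨s, hx⟩
    rw [hempty, if_neg hboth, if_neg (by tauto)]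
    simp

/-- In a minor of minimum degree at least that of the graph, a branch set containing an end `c`
contains no other end, and the blocks at `c` are not contracted at all. -/
lemma discrete_of_end_mem
    (hconn : ∀ w, (A.graph.induce (B w)).Connected)
    (hdisj : ∀ w w', w ≠ w' → Disjoint (B w) (B w'))
    (hadj : ∀ w w', K.Adj w w' → ∃ x ∈ B w, ∃ y ∈ B w', A.graph.Adj x y)
    (hdeg : ∀ w, 4 * Fintype.card L ≤ (K.neighborSet w).ncard)
    {w : W} {c : C} (hc : .inl c ∈ B w) :
    (∀ c', .inl c' ∈ B w → c' = c) ∧ ∀ b, A.Inc b c → A.Discrete B b := by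
  classical
  have := Fintype.ofFinite C
  set X : Finset C := Finset.univ.filter fun c => .inl c ∈ B w with hX
  set M : Finset L := Finset.univ.filter fun b => ∀ s, .inl (A.e b s) ∈ B w with hM
  set D : Finset L := Finset.univ.filter fun b => (∃ s, .inl (A.e b s) ∈ B w) ∧
    (¬ ∀ s, .inl (A.e b s) ∈ B w) ∧ ¬ A.Discrete B b with hD
  have hdeg' : 4 * Fintype.card L ≤ ∑ b, {w' | K.Adj w w' ∧ ∃ x ∈ B w, ∃ y ∈ B w',
      A.graph.Adj x y ∧ x ∈ A.block b ∧ y ∈ A.block b}.ncard := by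
    refine (hdeg w).trans (le_trans (Set.ncard_le_ncard ?_) (Set.ncard_iUnion_le_of_fintype _))
    intro w' hw'
    obtain ⟨x, hx, y, hy, hxy⟩ := hadj w w' hw'
    obtain ⟨b, hxb, hyb, -⟩ := A.exists_block_of_adj hxy
    exact Set.mem_iUnion.2 ⟨b, hw', x, hx, y, hy, hxy, hxb, hyb⟩
  have hsum := Finset.sum_le_sum fun b (_ : b ∈ Finset.univ) =>
    A.ncard_neighbors_across_le hconn hdisj hadj hdeg hc b
  rw [Finset.sum_add_distrib, Finset.sum_add_distrib, ← Finset.sum_filter, ← Finset.sum_filter,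
    ← hM, ← hD] at hsum
  have hX' : ∑ b, ∑ s, (if .inl (A.e b s) ∈ B w then 4 * A.weight b s else 0) =
      X.card * (4 * Fintype.card L) := by
    rw [← A.sum_sum_weight X]
    simp [hX]
  rw [hX'] at hsum
  simp only [Finset.sum_const, smul_eq_mul, mul_one] at hsum
  have hcard : X.card ≤ M.card + 1 := A.card_le_card_both (hconn w)
  have hmul := Nat.mul_le_mul_right (4 * Fintype.card L) hcard
  have hexp : M.card * (4 * Fintype.card L + 4) = M.card * (4 * Fintype.card L) + 4 * M.card := by
    ring
  rw [add_mul, one_mul] at hmul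
  -- With `d = 4 * card L`, the bounds read `d + |M| (d + 4) + |D| ≤ |X| d ≤ (|M| + 1) d`, hence `4
  -- |M| + |D| ≤ 0`.
  have hM0 : M.card = 0 := by omega
  have hD0 : D.card = 0 := by omega
  rw [Finset.card_eq_zero] at hM0 hD0
  have hX1 : X.card ≤ 1 := by simpa [hM0] using hcard
  refine ⟨fun c' hc' => Finset.card_le_one.1 hX1 _ (by simpa [hX] using hc') _
    (by simpa [hX] using hc), fun b hb => ?_⟩
  by_contra hd
  have hbM : b ∉ M := by simp [hM0]
  have hbD : b ∈ D := by
    rw [hD, Finset.mem_filter]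
    exact ⟨Finset.mem_univ _, ⟨_, by rwa [hb]⟩, fun h => hbM (by simpa [hM] using h), hd⟩
  simp [hD0] at hbD

/-- In a minor of minimum degree at least that of the graph, nothing is contracted or deleted. -/
lemma exists_branch_eq_singleton [Nonempty W]
    (hconn : ∀ w, (A.graph.induce (B w)).Connected)
    (hdisj : ∀ w w', w ≠ w' → Disjoint (B w) (B w'))
    (hadj : ∀ w w', K.Adj w w' → ∃ x ∈ B w, ∃ y ∈ B w', A.graph.Adj x y)
    (hdeg : ∀ w, 4 * Fintype.card L ≤ (K.neighborSet w).ncard) (x : C ⊕ L × L × Fin 4) :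
    ∃ w, B w = {x} := by
  have hend : ∀ {w c}, .inl c ∈ B w → _ := fun {w c} h =>
    A.discrete_of_end_mem hconn hdisj hadj hdeg h
  obtain ⟨c₀, hc₀⟩ : ∃ c w, .inl c ∈ B w := by
    obtain ⟨w⟩ := ‹Nonempty W›
    by_contra! h
    obtain ⟨⟨y, hy⟩⟩ := (hconn w).nonempty
    rcases y with c | ⟨b, p⟩
    · exact h c w hy
    · obtain ⟨w', hw', -⟩ := A.discrete_of_subset_interior hconn hdisj hadj hdeg
        (A.subset_interior (b := b) (hconn w) hy (by simp) fun s => h _ w)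
        (.inl (A.e b true)) (Or.inr ⟨_, rfl⟩)
      exact h _ w' hw'
  -- The blocks at a covered end are discrete, so their other ends are covered as well; this spreads
  -- over the whole tree.
  have hcov : ∀ c, ∃ w, .inl c ∈ B w := fun c => by
    refine A.conn (fun c => ∃ w, .inl c ∈ B w) ?_ c₀ c hc₀
    rintro b s t ⟨w, hw⟩
    obtain ⟨w', hw', -⟩ := (hend hw).2 b (A.inc_e b s) (.inl (A.e b t)) (Or.inr ⟨_, rfl⟩)
    exact ⟨w', hw'⟩
  have hdisc : ∀ b, A.Discrete B b := fun b =>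
    (hend (hcov (A.e b true)).choose_spec).2 b (A.inc_e b true)
  rcases x with c | ⟨b, p⟩
  · obtain ⟨w, hw⟩ := hcov c
    refine ⟨w, Set.eq_singleton_iff_unique_mem.2 ⟨hw, ?_⟩⟩
    rintro (c' | ⟨b, p⟩) hy
    · rw [(hend hw).1 c' hy]
    · exfalso
      by_cases h : ∃ s, .inl (A.e b s) ∈ B w
      · obtain ⟨s, hs⟩ := h
        obtain ⟨w', h1, h2⟩ := hdisc b (.inr (b, p)) (by simp)
        obtain rfl := eq_of_mem hdisj hy h1
        cases h2 _ (Or.inr ⟨s, rfl⟩) hs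
      · push Not at h
        exact inl_notMem_interior
          (A.subset_interior (b := b) (hconn w) hy (by simp) h hw)
  · obtain ⟨w, hw, huniq⟩ := hdisc b (.inr (b, p)) (by simp)
    refine ⟨w, Set.eq_singleton_iff_unique_mem.2 ⟨hw, fun y hy => huniq y ?_ hy⟩⟩
    refine A.interior_subset_block b (A.subset_interior (hconn w) hw (by simp) ?_ hy)
    intro s hs
    cases huniq _ (Or.inr ⟨s, rfl⟩) hs

end Minor

end EdgeTree

/-! ### From rigidity to minimality -/

namespace SimpleGraph

lemma IsMinor.refl {V : Type*} (G : SimpleGraph V) : G.IsMinor G := by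
  refine ⟨fun v => {v}, fun v => ?_, fun a b h => by simpa using h,
    fun a b h => ⟨a, rfl, b, rfl, h⟩⟩
  have : Nonempty ({v} : Set V) := ⟨⟨v, rfl⟩⟩
  exact ⟨fun x y => by rw [Subsingleton.elim x y]⟩

/-- The union of the branch sets over a connected set of vertices of a minor is connected. -/
lemma connected_biUnion_branch {V W : Type*} {G : SimpleGraph V} {H : SimpleGraph W}
    {B : W → Set V} (hconn : ∀ w, (G.induce (B w)).Connected)
    (hadj : ∀ a b, H.Adj a b → ∃ x ∈ B a, ∃ y ∈ B b, G.Adj x y)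
    {S : Set W} (hS : (H.induce S).Connected) : (G.induce (⋃ w ∈ S, B w)).Connected := by
  have hsub : ∀ w : S, B w.1 ⊆ ⋃ w ∈ S, B w := fun w => Set.subset_biUnion_of_mem w.2
  have key : ∀ a b : S, (H.induce S).Walk a b → ∀ x y (hx : x ∈ B a.1) (hy : y ∈ B b.1),
      (G.induce (⋃ w ∈ S, B w)).Reachable ⟨x, hsub a hx⟩ ⟨y, hsub b hy⟩ := by
    intro a b p
    induction p with
    | nil => exact fun x y hx hy => EdgeTree.reachable_of_subset _ (hconn _) hx hy
    | cons h _ ih =>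
      intro x y hx hy
      obtain ⟨x', hx', y', hy', hxy⟩ := hadj _ _ h
      have h1 := EdgeTree.reachable_of_subset (hsub _) (hconn _) hx hx'
      have h2 : (G.induce (⋃ w ∈ S, B w)).Adj ⟨x', hsub _ hx'⟩ ⟨y', hsub _ hy'⟩ := hxy
      exact h1.trans (h2.reachable.trans (ih y' y hy' hy))
  obtain ⟨w⟩ := hS.nonempty
  obtain ⟨x⟩ := (hconn w.1).nonempty
  have : Nonempty (⋃ w ∈ S, B w : Set V) := ⟨⟨x.1, hsub w x.2⟩⟩
  refine ⟨fun x y => ?_⟩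
  obtain ⟨x, hx⟩ := x
  obtain ⟨y, hy⟩ := y
  obtain ⟨a, ha, hxa⟩ := Set.mem_iUnion₂.1 hx
  obtain ⟨b, hb, hyb⟩ := Set.mem_iUnion₂.1 hy
  obtain ⟨p⟩ := hS.preconnected ⟨a, ha⟩ ⟨b, hb⟩
  exact key _ _ p x y hxa hyb

lemma ncard_neighborSet_eq_degree {V : Type*} (G : SimpleGraph V) (v : V)
    [Fintype (G.neighborSet v)] : (G.neighborSet v).ncard = G.degree v := by
  rw [Set.ncard_eq_toFinset_card', ← SimpleGraph.neighborFinset_def,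
    SimpleGraph.card_neighborFinset_eq_degree]

/-- A `d`-regular graph in which every minor of minimum degree at least `d` has all vertices as its
branch sets is a minimal forbidden minor. -/
lemma isMinimalForbiddenMinor_of_regular {V : Type} [Finite V] [Nonempty V] {G : SimpleGraph V}
    {d : ℕ} (hd : 0 < d) (hreg : ∀ v, (G.neighborSet v).ncard = d)
    (hrigid : ∀ (W : Type) [Finite W] [Nonempty W] (K : SimpleGraph W) (B : W → Set V),
      (∀ w, (G.induce (B w)).Connected) → (∀ w w', w ≠ w' → Disjoint (B w) (B w')) →
      (∀ w w', K.Adj w w' → ∃ x ∈ B w, ∃ y ∈ B w', G.Adj x y) →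
      (∀ w, d ≤ (K.neighborSet w).ncard) → ∀ x, ∃ w, B w = {x}) :
    G.IsMinimalForbiddenMinor (MinorMinDegreeLE (d - 1)) := by
  constructor
  · intro h
    classical
    have := Fintype.ofFinite V
    have h1 := h V G (IsMinor.refl G)
    have h2 : d ≤ G.minDegree := G.le_minDegree_of_forall_le_degree d fun v => by
      rw [← ncard_neighborSet_eq_degree, hreg]
    omega
  · rintro X _ H ⟨⟨B, hB1, hB2, hB3⟩, hne⟩ W _ K _ ⟨D, hD1, hD2, hD3⟩
    by_contra hK
    have hW : Nonempty W := by
      by_contra hW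
      rw [not_nonempty_iff] at hW
      exact hK (by simp)
    have hKdeg : ∀ w, d ≤ (K.neighborSet w).ncard := fun w => by
      rw [ncard_neighborSet_eq_degree]
      have := K.minDegree_le_degree w
      omega
    -- A minor `K` of the minor `H` is a minor of `G`, with unions of branch sets as its branch
    -- sets.
    have hsing := hrigid W K (fun w => ⋃ h ∈ D w, B h)
      (fun w => connected_biUnion_branch hB1 hB3 (hD1 w))
      (fun w w' hww' => by
        rw [Set.disjoint_left]
        intro x hx hx'
        obtain ⟨a, ha, hxa⟩ := Set.mem_iUnion₂.1 hx
        obtain ⟨a', ha', hxa'⟩ := Set.mem_iUnion₂.1 hx'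
        obtain rfl := EdgeTree.eq_of_mem hB2 hxa hxa'
        exact hww' (EdgeTree.eq_of_mem hD2 ha ha'))
      (fun w w' hww' => by
        obtain ⟨a, ha, a', ha', haa'⟩ := hD3 w w' hww'
        obtain ⟨x, hx, y, hy, hxy⟩ := hB3 a a' haa'
        exact ⟨x, Set.mem_iUnion₂.2 ⟨a, ha, hx⟩, y, Set.mem_iUnion₂.2 ⟨a', ha', hy⟩, hxy⟩)
      hKdeg
    have hBne : ∀ h, (B h).Nonempty := fun h => Set.nonempty_coe_sort.1 (hB1 h).nonempty
    -- A union of nonempty disjoint sets is a singleton only if it has one member and that member is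
    -- a singleton; so neither minor contracts anything.
    have key : ∀ h, ∃ x w, B h = {x} ∧ D w = {h} := by
      intro h
      obtain ⟨x, hx⟩ := hBne h
      obtain ⟨w, hw⟩ := hsing x
      have hsub : ∀ h' ∈ D w, B h' ⊆ {x} := fun h' hh' => by
        rw [← hw]; exact Set.subset_biUnion_of_mem (u := B) hh'
      have hall : ∀ h' ∈ D w, h' = h := fun h' hh' => by
        obtain ⟨y, hy⟩ := hBne h'
        obtain rfl := hsub h' hh' hy
        exact EdgeTree.eq_of_mem hB2 hy hx
      obtain ⟨⟨h', hh'⟩⟩ := (hD1 w).nonempty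
      have hmem : h ∈ D w := hall h' hh' ▸ hh'
      exact ⟨x, w, Set.eq_singleton_iff_unique_mem.2 ⟨hx, hsub h hmem⟩,
        Set.eq_singleton_iff_unique_mem.2 ⟨hmem, hall⟩⟩
    choose a k ha hk using key
    have ha_inj : Function.Injective a := fun h h' hh => by
      refine EdgeTree.eq_of_mem hB2 (x := a h) ?_ ?_
      · rw [ha]; rfl
      · rw [ha, hh]; rfl
    have ha_surj : Function.Surjective a := fun x => by
      obtain ⟨w, hw⟩ := hsing x
      obtain ⟨⟨h, hh⟩⟩ := (hD1 w).nonempty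
      refine ⟨h, ?_⟩
      have : a h ∈ ({x} : Set V) := by
        rw [← hw]
        exact Set.mem_iUnion₂.2 ⟨h, hh, by rw [ha]; rfl⟩
      exact this
    have hadj : ∀ h h', H.Adj h h' → G.Adj (a h) (a h') := by
      intro h h' hh
      obtain ⟨x, hx, y, hy, hxy⟩ := hB3 h h' hh
      rw [ha] at hx hy
      obtain rfl := hx
      obtain rfl := hy
      exact hxy
    have hk' : ∀ w, ∃ h, k h = w := fun w => by
      obtain ⟨⟨h, hh⟩⟩ := (hD1 w).nonempty
      refine ⟨h, EdgeTree.eq_of_mem hD2 (x := h) ?_ hh⟩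
      rw [hk]; rfl
    have hHdeg : ∀ h, d ≤ (H.neighborSet h).ncard := by
      intro h
      refine (hKdeg (k h)).trans ((Set.ncard_le_ncard ?_).trans
        (Set.ncard_image_le (f := k) (Set.toFinite (H.neighborSet h))))
      intro w hw
      obtain ⟨h', rfl⟩ := hk' w
      obtain ⟨x, hx, y, hy, hxy⟩ := hD3 _ _ hw
      rw [hk] at hx hy
      obtain rfl := hx
      obtain rfl := hy
      exact ⟨_, hxy, rfl⟩
    have hadj' : ∀ h h', G.Adj (a h) (a h') → H.Adj h h' := by
      intro h h' hh
      -- The injection `a` sends at least `d` neighbours of `h` into the `d` neighbours of `a h`, so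
      -- no edge of `G` is lost in `H`.
      have heq : a '' H.neighborSet h = G.neighborSet (a h) := by
        refine Set.eq_of_subset_of_ncard_le ?_ ?_
        · rintro _ ⟨h'', hh'', rfl⟩
          exact hadj _ _ hh''
        · rw [hreg, ha_inj.injOn.ncard_image]
          exact hHdeg h
      obtain ⟨h'', hh'', he⟩ : a h' ∈ a '' H.neighborSet h := by rw [heq]; exact hh
      rwa [← ha_inj he]
    exact hne ⟨⟨Equiv.ofBijective a ⟨ha_inj, ha_surj⟩, fun {h h'} => ⟨hadj' h h', hadj h h'⟩⟩⟩

/-! ### Low-high trees as edge trees -/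

lemma IsLowHighTree.of_iso {U U' : Type*} [Fintype U] [Fintype U'] {T : SimpleGraph U}
    {T' : SimpleGraph U'} [DecidableRel T.Adj] [DecidableRel T'.Adj] (f : T ≃g T')
    (h : T.IsLowHighTree) : T'.IsLowHighTree := by
  obtain ⟨hT, Vl, Vh, hun, hbip, hl, hh⟩ := h
  refine ⟨f.isTree_iff.1 hT, f.symm ⁻¹' Vl, f.symm ⁻¹' Vh, ?_, ⟨?_, ?_⟩, ?_, ?_⟩
  · rw [← Set.preimage_union, hun, Set.preimage_univ]
  · exact hbip.disjoint.preimage _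
  · intro v w hvw
    exact hbip.mem_of_adj (f.symm.map_adj_iff.2 hvw)
  · intro v hv
    rw [← f.symm.degree_eq]
    exact hl _ hv
  · intro v hv
    rw [← f.symm.degree_eq]
    exact hh _ hv

/-- A low-high tree is obtained from a tree with edge set `Vl` by subdividing all edges and deleting
the leaves: `C` consists of the high vertices and of one leaf for each low vertex of degree 1. -/
lemma IsLowHighTree.exists_edgeTree {U : Type*} [Fintype U] [Nontrivial U] {T : SimpleGraph U}
    [DecidableRel T.Adj] (hT : T.IsLowHighTree) :
    ∃ (Vl Vh C : Set U) (A : EdgeTree Vl C), Vl.Nontrivial ∧ Vl ∪ Vh = Set.univ ∧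
      T.IsBipartiteWith Vl Vh ∧ Vh ⊆ C ∧ (∀ b : Vl, ∃ c ∈ Vh, T.Adj b c) ∧
      (∀ (b : Vl) (c : C), c.1 ∈ Vh → (T.Adj b c ↔ A.Inc b c)) ∧
      (∀ c : C, c.1 ∈ Vh ↔ ∃ b b', b ≠ b' ∧ A.Inc b c ∧ A.Inc b' c) := by
  classical
  obtain ⟨⟨hconn, hacyc⟩, Vl, Vh, hun, hbip, hl, hh⟩ := hT
  have hdisj : ∀ u, u ∈ Vl → u ∉ Vh := fun _ h =>
    Set.disjoint_left.1 hbip.disjoint h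
  have hlh : ∀ {u v}, T.Adj u v → u ∈ Vl → v ∈ Vh := fun {u v} h hu =>
    (hbip.mem_of_adj h).elim And.right fun h' => (hdisj u hu h'.1).elim
  have hhl : ∀ {u v}, T.Adj u v → u ∈ Vh → v ∈ Vl := fun {u v} h hu =>
    (hbip.mem_of_adj h).elim (fun h' => (hdisj u h'.1 hu).elim) And.right
  -- `n` is a neighbour of the low vertex `v`, and `o` its other neighbour, or `v` itself as a dummy
  -- end when `v` is a leaf.
  have hends : ∀ v, ∃ n o, v ∈ Vl → T.Adj v n ∧ n ≠ o ∧ (o = v ∨ T.Adj v o) ∧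
      ∀ x, T.Adj v x → x = n ∨ x = o := by
    intro v
    by_cases hv : v ∈ Vl
    · have h1 := hl v hv
      have h2 := hconn.preconnected.degree_pos_of_nontrivial v
      rw [← card_neighborFinset_eq_degree] at h1 h2
      obtain h3 | h3 : (T.neighborFinset v).card = 1 ∨ (T.neighborFinset v).card = 2 := by omega
      · obtain ⟨n, hn⟩ := Finset.card_eq_one.1 h3
        have hx : ∀ x, T.Adj v x ↔ x = n := fun x => by
          rw [← mem_neighborFinset, hn, Finset.mem_singleton]
        exact ⟨n, v, fun _ => ⟨(hx n).2 rfl, ((hx n).2 rfl).ne', Or.inl rfl,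
          fun x h => Or.inl ((hx x).1 h)⟩⟩
      · obtain ⟨n, o, hne, hn⟩ := Finset.card_eq_two.1 h3
        have hx : ∀ x, T.Adj v x ↔ x = n ∨ x = o := fun x => by
          rw [← mem_neighborFinset, hn, Finset.mem_insert, Finset.mem_singleton]
        exact ⟨n, o, fun _ => ⟨(hx n).2 (Or.inl rfl), hne, Or.inr ((hx o).2 (Or.inr rfl)),
          fun x h => (hx x).1 h⟩⟩
    · exact ⟨v, v, fun h => (hv h).elim⟩
  choose n o hno using hends
  let C : Set U := Vh ∪ {x | x ∈ Vl ∧ o x = x}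
  have hnC : ∀ b : Vl, n b ∈ C := fun b => Or.inl (hlh (hno b b.2).1 b.2)
  have hoC : ∀ b : Vl, o b ∈ C := fun b => by
    rcases (hno b b.2).2.2.1 with h | h
    · exact Or.inr ⟨h.symm ▸ b.2, by rw [h, h]⟩
    · exact Or.inl (hlh h b.2)
  let e : Vl → Bool → C := fun b s => bif s then ⟨n b, hnC b⟩ else ⟨o b, hoC b⟩
  have he : ∀ b s, (e b s).1 = b ∨ T.Adj b (e b s).1 := by
    rintro b (_ | _)
    · exact (hno b b.2).2.2.1
    · exact Or.inr (hno b b.2).1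
  have hadj_e : ∀ (b : Vl) (c : C), c.1 ∈ Vh → (T.Adj b c ↔ ∃ s, e b s = c) := by
    intro b c hc
    constructor
    · intro h
      rcases (hno b b.2).2.2.2 _ h with h | h
      · exact ⟨true, Subtype.ext h.symm⟩
      · exact ⟨false, Subtype.ext h.symm⟩
    · rintro ⟨s, rfl⟩
      refine (he b s).resolve_left fun h => hdisj b b.2 ?_
      rwa [h] at hc
  -- Deleting the single edge from `b` to `n b` suffices: it is a bridge, and `o b` stays on the
  -- side of `b`.
  let side : Vl → C → Bool := fun b c =>
    decide ((T.deleteEdges {s(b.1, n b)}).Reachable (n b) c)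
  have hside : ∀ b s, side b (e b s) = s := by
    rintro b (_ | _)
    · refine decide_eq_false fun h => ?_
      have hb := (isAcyclic_iff_forall_adj_isBridge.1 hacyc) (hno b b.2).1
      rw [isBridge_iff] at hb
      refine hb ?_
      rcases (hno b b.2).2.2.1 with h' | h'
      · have h2 : (T.deleteEdges {s(b.1, n b)}).Reachable (n b) (o b) := h
        rw [h'] at h2
        exact h2.symm
      · have h2 : (T.deleteEdges {s(b.1, n b)}).Adj b (o b) := by
          rw [deleteEdges_adj]
          refine ⟨h', fun h3 => ?_⟩
          rw [Set.mem_singleton_iff, Sym2.eq_iff] at h3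
          rcases h3 with ⟨-, h3⟩ | ⟨h3, -⟩
          · exact (hno b b.2).2.1 h3.symm
          · exact (hno b b.2).1.ne h3
        exact h2.reachable.trans h.symm
    · exact decide_eq_true (Reachable.refl _)
  have hside_eq : ∀ b b₁, b₁ ≠ b → ∀ s t, side b (e b₁ s) = side b (e b₁ t) := by
    intro b b₁ hne
    have key : ∀ s, (T.deleteEdges {s(b.1, n b)}).Reachable b₁ (e b₁ s).1 := by
      intro s
      rcases he b₁ s with h | h
      · rw [h]
      · refine Adj.reachable ?_
        rw [deleteEdges_adj]
        refine ⟨h, fun h3 => ?_⟩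
        rw [Set.mem_singleton_iff, Sym2.eq_iff] at h3
        rcases h3 with ⟨h3, -⟩ | ⟨h3, -⟩
        · exact hne (Subtype.ext h3)
        · refine hdisj b₁ b₁.2 ?_
          rw [h3]
          exact hlh (hno b b.2).1 b.2
    intro s t
    refine decide_eq_decide.2 ⟨fun h => ?_, fun h => ?_⟩
    · exact (h.trans (key s).symm).trans (key t)
    · exact (h.trans (key t).symm).trans (key s)
  have hconn' : ∀ P : C → Prop, (∀ b s t, P (e b s) → P (e b t)) → ∀ c c', P c → P c' := by
    intro P hP
    -- Transfers `P` to all of `T`, reading it for a low vertex at one of its ends, so that the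
    -- connectedness of `T` applies.
    let Q : U → Prop := fun u =>
      (∀ h : u ∈ Vl, P (e ⟨u, h⟩ true)) ∧ ∀ h : u ∈ Vh, P ⟨u, Or.inl h⟩
    have hQ : ∀ c : C, P c ↔ Q c := by
      rintro ⟨c, hc | ⟨hc, hoc⟩⟩
      · exact ⟨fun h => ⟨fun h' => (hdisj c h' hc).elim, fun _ => h⟩, fun h => h.2 hc⟩
      · have h1 : e ⟨c, hc⟩ false = ⟨c, Or.inr ⟨hc, hoc⟩⟩ := Subtype.ext hoc
        have h2 : P ⟨c, Or.inr ⟨hc, hoc⟩⟩ ↔ P (e ⟨c, hc⟩ true) := by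
          rw [← h1]
          exact ⟨hP _ _ _, hP _ _ _⟩
        exact ⟨fun h => ⟨fun _ => h2.1 h, fun h' => (hdisj c hc h').elim⟩, fun h => h2.2 (h.1 hc)⟩
    have hlow : ∀ (b : Vl) s, Q b ↔ P (e b s) := fun b s =>
      ⟨fun h => hP _ _ _ (h.1 b.2), fun h => ⟨fun _ => hP _ _ _ h, fun h' => (hdisj b b.2 h').elim⟩⟩
    have hedge : ∀ (b : Vl) (c : U) (hc : c ∈ Vh), T.Adj b c → (Q b ↔ Q c) := by
      intro b c hc hbc
      obtain ⟨s, hs⟩ := (hadj_e b ⟨c, Or.inl hc⟩ hc).1 hbc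
      rw [hlow b s, hs]
      exact hQ _
    have hwalk : ∀ u v, T.Reachable u v → Q u → Q v := by
      rintro u v ⟨p⟩
      induction p with
      | nil => exact id
      | cons h _ ih =>
        intro hu
        refine ih ?_
        rcases hbip.mem_of_adj h with ⟨h1, h2⟩ | ⟨h1, h2⟩
        · exact (hedge ⟨_, h1⟩ _ h2 h).1 hu
        · exact (hedge ⟨_, h2⟩ _ h1 h.symm).2 hu
    intro c c' hc
    rw [hQ] at hc ⊢
    exact hwalk _ _ (hconn.preconnected _ _) hc
  let A : EdgeTree Vl C := ⟨e, side, hside, hside_eq, hconn'⟩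
  have hinc : ∀ (b : Vl) (c : C), A.Inc b c ↔ ∃ s, e b s = c := fun b c =>
    ⟨fun h => ⟨_, h⟩, by rintro ⟨s, rfl⟩; exact A.inc_e b s⟩
  have htwo : ∀ c ∈ Vh, ∃ b b', b ≠ b' ∧ T.Adj c b ∧ T.Adj c b' := by
    intro c hc
    have h := hh c hc
    rw [← card_neighborFinset_eq_degree] at h
    obtain ⟨b, hb, b', hb', hne⟩ := Finset.one_lt_card.1 h
    rw [mem_neighborFinset] at hb hb'
    exact ⟨b, b', hne, hb, hb'⟩
  refine ⟨Vl, Vh, C, A, ?_, hun, hbip, fun _ h => Or.inl h,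
    fun b => ⟨n b, hlh (hno b b.2).1 b.2, (hno b b.2).1⟩,
    fun b c hc => (hadj_e b c hc).trans (hinc b c).symm, fun c => ⟨fun hc => ?_, ?_⟩⟩
  · obtain ⟨c, hc⟩ : Vh.Nonempty := by
      obtain ⟨u⟩ := hconn.nonempty
      obtain ⟨v, huv⟩ := hconn.preconnected.exists_adj_of_nontrivial u
      rcases hbip.mem_of_adj huv with h | h
      · exact ⟨_, h.2⟩
      · exact ⟨_, h.1⟩
    obtain ⟨b, b', hne, hb, hb'⟩ := htwo c hc
    exact ⟨b, hhl hb hc, b', hhl hb' hc, hne⟩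
  · obtain ⟨b, b', hne, hb, hb'⟩ := htwo c hc
    exact ⟨⟨b, hhl hb hc⟩, ⟨b', hhl hb' hc⟩, fun h => hne (congrArg Subtype.val h),
      (hinc _ _).2 ((hadj_e ⟨b, _⟩ c hc).1 hb.symm),
      (hinc _ _).2 ((hadj_e ⟨b', _⟩ c hc).1 hb'.symm)⟩
  · rintro ⟨b, b', hne, hb, hb'⟩
    rcases c.2 with hc | ⟨hc, -⟩
    · exact hc
    · exfalso
      -- A dummy end is low, hence not adjacent to any low vertex, so the only edge at it is the
      -- leaf it stands for.
      have key : ∀ b : Vl, A.Inc b c → b.1 = c := by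
        intro b hb
        obtain ⟨s, rfl⟩ := (hinc b c).1 hb
        refine ((he b s).resolve_right fun h => ?_).symm
        exact hdisj _ hc (hlh h b.2)
      exact hne (Subtype.ext ((key b hb).trans (key b' hb').symm))

/-! ### The block decomposition tree and the final assembly -/

lemma blockGraph_adj_inl_inr {V : Type*} {G : SimpleGraph V} (S : {S : Set V // G.IsBlock S})
    (c : {c : V // G.IsCutVertex c}) : G.blockGraph.Adj (.inl S) (.inr c) ↔ c.1 ∈ S.1 := by
  constructor
  · rintro ⟨-, ⟨b, c', h1, h2, h⟩ | ⟨b, c', h1, h2, h⟩⟩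
    · cases h1; cases h2; exact h
    · cases h1
  · intro h
    exact ⟨Sum.inl_ne_inr, Or.inl ⟨S, c, rfl, rfl, h⟩⟩

lemma not_blockGraph_adj_inl_inl {V : Type*} {G : SimpleGraph V} (S S' : {S : Set V // G.IsBlock S}) :
    ¬ G.blockGraph.Adj (.inl S) (.inl S') := by
  rintro ⟨-, ⟨b, c', h1, h2, h⟩ | ⟨b, c', h1, h2, h⟩⟩ <;> cases h2

lemma not_blockGraph_adj_inr_inr {V : Type*} {G : SimpleGraph V}
    (c c' : {c : V // G.IsCutVertex c}) : ¬ G.blockGraph.Adj (.inr c) (.inr c') := by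
  rintro ⟨-, ⟨b, c', h1, h2, h⟩ | ⟨b, c', h1, h2, h⟩⟩ <;> cases h1

end SimpleGraph

/-- If a tree is obtained from an edge tree by subdividing all edges and deleting the leaves, then
it is the block decomposition tree of the graph of the edge tree. -/
lemma EdgeTree.nonempty_iso_blockGraph {U : Type*} {T : SimpleGraph U} {Vl Vh C : Set U}
    (A : EdgeTree Vl C) (hun : Vl ∪ Vh = Set.univ) (hbip : T.IsBipartiteWith Vl Vh) (hVh : Vh ⊆ C)
    (hadj : ∀ (b : Vl) (c : C), c.1 ∈ Vh → (T.Adj b c ↔ A.Inc b c))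
    (hcut : ∀ c : C, c.1 ∈ Vh ↔ ∃ b b', b ≠ b' ∧ A.Inc b c ∧ A.Inc b' c) :
    Nonempty (T ≃g A.graph.blockGraph) := by
  classical
  have hdisj : ∀ u, u ∈ Vl → u ∉ Vh := fun _ h =>
    Set.disjoint_left.1 hbip.disjoint h
  have hh : ∀ {u}, u ∉ Vl → u ∈ Vh := fun {u} hu =>
    ((Set.ext_iff.1 hun u).2 trivial).resolve_left hu
  have hcut' : ∀ {u} (hu : u ∈ Vh), A.graph.IsCutVertex (.inl ⟨u, hVh hu⟩) := fun {u} hu =>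
    A.isCutVertex_iff.2 ⟨_, rfl, (hcut ⟨u, hVh hu⟩).1 hu⟩
  let F : U → {S // A.graph.IsBlock S} ⊕ {c // A.graph.IsCutVertex c} := fun u =>
    if h : u ∈ Vl then .inl ⟨A.block ⟨u, h⟩, A.isBlock_iff.2 ⟨_, rfl⟩⟩
    else .inr ⟨.inl ⟨u, hVh (hh h)⟩, hcut' (hh h)⟩
  have hFl : ∀ u (h : u ∈ Vl), F u = .inl ⟨A.block ⟨u, h⟩, A.isBlock_iff.2 ⟨_, rfl⟩⟩ :=
    fun u h => dif_pos h
  have hFh : ∀ u (h : u ∈ Vh), F u = .inr ⟨.inl ⟨u, hVh h⟩, hcut' h⟩ :=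
    fun u h => dif_neg fun h' => hdisj u h' h
  have hcases : ∀ u, u ∈ Vl ∨ u ∈ Vh := fun u => (Set.ext_iff.1 hun u).2 trivial
  have hmix : ∀ u v (hu : u ∈ Vl) (hv : v ∈ Vh),
      A.graph.blockGraph.Adj (F u) (F v) ↔ T.Adj u v := by
    intro u v hu hv
    rw [hFl u hu, hFh v hv, SimpleGraph.blockGraph_adj_inl_inr, A.inl_mem_block]
    exact (hadj ⟨u, hu⟩ ⟨v, hVh hv⟩ hv).symm
  refine ⟨⟨Equiv.ofBijective F ⟨?_, ?_⟩, ?_⟩⟩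
  · intro u v h
    rcases hcases u with hu | hu <;> rcases hcases v with hv | hv
    · rw [hFl u hu, hFl v hv] at h
      have h1 : A.block ⟨u, hu⟩ = A.block ⟨v, hv⟩ := congrArg Subtype.val (Sum.inl_injective h)
      exact congrArg Subtype.val (A.eq_of_block_subset h1.le)
    · rw [hFl u hu, hFh v hv] at h; cases h
    · rw [hFh u hu, hFl v hv] at h; cases h
    · rw [hFh u hu, hFh v hv] at h
      exact congrArg Subtype.val (Sum.inl_injective (congrArg Subtype.val (Sum.inr_injective h)))
  · rintro (⟨S, hS⟩ | ⟨x, hx⟩)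
    · obtain ⟨b, rfl⟩ := A.isBlock_iff.1 hS
      exact ⟨b, hFl b b.2⟩
    · obtain ⟨c, rfl, h⟩ := A.isCutVertex_iff.1 hx
      exact ⟨c, hFh c ((hcut c).2 h)⟩
  · intro u v
    change A.graph.blockGraph.Adj (F u) (F v) ↔ T.Adj u v
    rcases hcases u with hu | hu <;> rcases hcases v with hv | hv
    · rw [hFl u hu, hFl v hv]
      refine iff_of_false (SimpleGraph.not_blockGraph_adj_inl_inl _ _) fun h => ?_
      rcases hbip.mem_of_adj h with h | h
      · exact hdisj v hv h.2
      · exact hdisj u hu h.1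
    · exact hmix u v hu hv
    · rw [SimpleGraph.adj_comm, hmix v u hv hu, SimpleGraph.adj_comm]
    · rw [hFh u hu, hFh v hv]
      refine iff_of_false (SimpleGraph.not_blockGraph_adj_inr_inr _ _) fun h => ?_
      rcases hbip.mem_of_adj h with h | h
      · exact hdisj u h.1 hu
      · exact hdisj v h.2 hv

theorem mainTheorem5 {U : Type*} [Fintype U] [Nontrivial U] (T : SimpleGraph U)
    [DecidableRel T.Adj] (hT : T.IsLowHighTree) :
    ∃ (d : ℕ) (V : Type) (_ : Fintype V) (G : SimpleGraph V) (_ : DecidableRel G.Adj),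
      G.IsRegularOfDegree d ∧
      T.IsBlockDecompositionTreeOf G ∧
      8 ≤ d ∧ d ≤ 4 * T.edgeFinset.card ∧
      G.IsMinimalForbiddenMinor (SimpleGraph.MinorMinDegreeLE (d - 1)) := by
  classical
  -- `U` may live in any universe, but `V` must be in `Type`, so `T` is first moved to `Fin`.
  let f := SimpleGraph.Iso.map (Fintype.equivFin U) T
  have : Nontrivial (Fin (Fintype.card U)) := (Fintype.equivFin U).symm.nontrivial
  obtain ⟨Vl, Vh, C, A, hnt, hun, hbip, hVh, hex, hadj, hcut⟩ := (hT.of_iso f).exists_edgeTree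
  have : Nontrivial Vl := hnt.coe_sort
  have : Nonempty (C ⊕ Vl × Vl × Fin 4) := ⟨.inl (A.e (Classical.arbitrary Vl) true)⟩
  have hreg := A.ncard_neighborSet
  obtain ⟨g⟩ := A.nonempty_iso_blockGraph hun hbip hVh hadj hcut
  refine ⟨4 * Fintype.card Vl, C ⊕ Vl × Vl × Fin 4, inferInstance, A.graph, inferInstance,
    fun v => ?_, ⟨A.graph_connected, ⟨f.trans g⟩⟩, ?_, ?_, ?_⟩
  · rw [← SimpleGraph.ncard_neighborSet_eq_degree, hreg]
  · have := Fintype.one_lt_card (α := Vl)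
    omega
  · rw [f.card_edgeFinset_eq]
    refine Nat.mul_le_mul_left 4 ?_
    choose n hn hbn using hex
    rw [← Finset.card_univ]
    -- Choosing one edge of `T` at each low vertex is injective, as an edge has only one low end.
    refine Finset.card_le_card_of_injOn (fun b : Vl => s(b.1, n b)) (fun b _ => ?_) ?_
    · simpa using hbn b
    · intro b _ b' _ h
      rcases Sym2.eq_iff.1 h with ⟨h, -⟩ | ⟨h, -⟩
      · exact Subtype.ext h
      · refine (Set.disjoint_left.1 hbip.disjoint b.2 ?_).elim
        rw [h]
        exact hn b'
  · refine SimpleGraph.isMinimalForbiddenMinor_of_regular (by have := Fintype.card_pos (α := Vl); omega)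
      hreg fun W _ _ K B h1 h2 h3 h4 => A.exists_branch_eq_singleton h1 h2 h3 h4
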